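/- Let $\mathfrak A$ be a complex unital algebra and let $\varphi,\psi:\mathfrak A\to\mathbb C$ be linear functionals with $\varphi(1)=\psi(1)=1$. The free cumulants $R^n$ and the c-free cumulants ${}^cR^n$ ($n\ge 1$) are defined by the recurrences $$\psi(a_1\cdots a_n)=\sum_{p=1}^n\ \sum_{1=i(1)<\dots<i(p)\le n}R^p(a_{i(1)},\dots,a_{i(p)})\Big[\prod_{k=1}^{p-1}\psi(a_{i(k)+1}\cdots a_{i(k+1)-1})\Big]\psi(a_{i(p)+1}\cdots a_n),$$ $$\varphi(a_1\cdots a_n)=\sum_{p=1}^n\ \sum_{1=i(1)<\dots<i(p)\le n}{}^cR^p(a_{i(1)},\dots,a_{i(p)})\Big[\prod_{k=1}^{p-1}\psi(a_{i(k)+1}\cdots a_{i(k+1)-1})\Big]\varphi(a_{i(p)+1}\cdots a_n)$$ (empty products being $1$). For $X\in\mathfrak A$ put $R_X(z)=\sum_{n\ge1}R^n(X,\dots,X)z^n$ and ${}^cR_X(z)=\sum_{n\ge1}{}^cR^n(X,\dots,X)z^n$, as formal power series. Elements $X,Y\in\mathfrak A$ are called c-free if, with $\mathfrak A_1,\mathfrak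 A_2$ the unital subalgebras generated by $X$ and by $Y$, one has $\psi(a_1\cdots a_n)=0$ and $\varphi(a_1\cdots a_n)=\varphi(a_1)\cdots\varphi(a_n)$ for all $n\ge1$ and all $a_j\in\mathfrak A_{\varepsilon(j)}$ with $\psi(a_j)=0$ ($1\le j\le n$), where $\varepsilon(j)\in\{1,2\}$ and $\varepsilon(j)\ne\varepsilon(j+1)$ for $1\le j<n$. For formal power series $f(z)=\sum_{n\ge1}a_nz^n$, $g(z)=\sum_{n\ge1}b_nz^n$, let $$(f\,\check\star\,g)(z)=\sum_{n\ge1}\lambda_nz^n,\qquad \lambda_n=\sum_{\substack{\pi\in NC(n)\\ \{1\}\in\pi}}\ \prod_{B\in\pi}a_{|B|}\prod_{C\in Kr(\pi)}b_{|C|},$$ where $NC(n)$ is the set of non-crossing partitions of $\{1,\dots,n\}$ and $Kr(\pi)$ is the Kreweras complement of $\pi$, that is, the biggest (coarsest) $\sigma\in NC(\bar 1,\dots,\bar n)\cong NC(n)$ such that $\pi\cup\sigma$ is non-crossing on $1<\bar 1<2<\bar 2<\dots<n<\bar n$. **Theorem.** Let $X,Y\in\mathfrak A$ be c-free with $\psi(X)\neq0\neq\psi(Y)$,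 and let $\alpha_1=\psi(X)$ and $\beta_1=\psi(Y)$ be the first coefficients of $R_X$ and $R_Y$. Then $$\frac1z\,{}^cR_{XY}(z)=\left[\Big(\frac1z\,{}^cR_X\Big)\circ\Big(\frac1{\alpha_1}R_X\,\check\star\,R_Y\Big)\right]\cdot\left[\Big(\frac1z\,{}^cR_Y\Big)\circ\Big(\frac1{\beta_1}R_Y\,\check\star\,R_X\Big)\right]$$ as formal power series. -/

import Mathlib

open scoped PowerSeries

namespace CFree

section Independence

variable {A : Type*} [Ring A] [Algebra ℂ A]

/-- Conditional freeness with respect to `(φ, ψ)` of a family of (unital) subalgebras: for every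
word `a 0, …, a n` (of length `n + 1 ≥ 1`) whose neighbouring letters come from different
subalgebras and whose letters are all `ψ`-centred, `ψ` of the product vanishes and `φ` of the
product is the product of the values of `φ`. -/
def CondFreeSubalgebras (φ ψ : A →ₗ[ℂ] ℂ) {ι : Type*} (S : ι → Subalgebra ℂ A) : Prop :=
  ∀ (n : ℕ) (ε : Fin (n + 1) → ι) (a : Fin (n + 1) → A),
    (∀ j, a j ∈ S (ε j)) →
    (∀ j : Fin n, ε j.castSucc ≠ ε j.succ) →
    (∀ j, ψ (a j) = 0) →
    ψ (List.ofFn a).prod = 0 ∧ φ (List.ofFn a).prod = ∏ j, φ (a j)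

/-- Two elements are c-free if the unital subalgebras that they generate are. -/
def CondFree (φ ψ : A →ₗ[ℂ] ℂ) (X Y : A) : Prop :=
  CondFreeSubalgebras φ ψ ![Algebra.adjoin ℂ {X}, Algebra.adjoin ℂ {Y}]

end Independence

section Cumulants

variable {A : Type*} [Ring A]

/-- A choice of indices `1 = i(1) < i(2) < ⋯ < i(p) ≤ n` is the same as a composition `c` of `n`
with `p` blocks, `i(k)` being the first element of the `k`-th block. This is the tuple
`a_{i(1)}, …, a_{i(p)}`. -/
def heads {n : ℕ} (c : Composition n) (a : Fin n → A) : Fin c.length → A :=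
  fun k => a (c.embedding k ⟨0, c.one_le_blocksFun k⟩)

/-- The product of the letters strictly after `i(k)` and strictly before `i(k+1)`
(up to the end of the word, if `k` is the last index). -/
def gap {n : ℕ} (c : Composition n) (a : Fin n → A) (k : Fin c.length) : A :=
  (List.ofFn fun j => a (c.embedding k j)).tail.prod

theorem gap_ones {n : ℕ} (a : Fin n → A) (k : Fin (Composition.ones n).length) :
    gap (Composition.ones n) a k = 1 := by
  have h : (List.ofFn fun j => a ((Composition.ones n).embedding k j)).tail = [] := by
    apply List.eq_nil_of_length_eq_zero
    simp
  rw [gap, h, List.prod_nil]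

variable [Algebra ℂ A]

/-- The free cumulants `Rⁿ(a₁, …, aₙ)` with respect to `ψ`, by recursion on `n`: the defining
recurrence (`moment_eq_sum_freeCumulant`) solved for its term with `p = n`. -/
noncomputable def freeCumulant (ψ : A →ₗ[ℂ] ℂ) (n : ℕ) (a : Fin n → A) : ℂ :=
  ψ (List.ofFn a).prod -
    ∑ c : {c : Composition n // c.length < n},
      freeCumulant ψ c.1.length (heads c.1 a) * ∏ k, ψ (gap c.1 a k)
termination_by n
decreasing_by exact c.2

/-- The c-free cumulants `ᶜRⁿ(a₁, …, aₙ)` with respect to `(φ, ψ)`, by recursion on `n`: the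
defining recurrence (`moment_eq_sum_cfreeCumulant`) solved for its term with `p = n`. The gap
after the last chosen index is evaluated with `φ`, the others with `ψ`. -/
noncomputable def cfreeCumulant (φ ψ : A →ₗ[ℂ] ℂ) (n : ℕ) (a : Fin n → A) : ℂ :=
  φ (List.ofFn a).prod -
    ∑ c : {c : Composition n // c.length < n},
      cfreeCumulant φ ψ c.1.length (heads c.1 a) *
        ∏ k : Fin c.1.length,
          if (k : ℕ) + 1 = c.1.length then φ (gap c.1 a k) else ψ (gap c.1 a k)
termination_by n
decreasing_by exact c.2

/-- The series `R_X(z) = ∑_{n ≥ 1} Rⁿ(X, …, X) zⁿ`. -/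
noncomputable def RTransform (ψ : A →ₗ[ℂ] ℂ) (X : A) : ℂ⟦X⟧ :=
  PowerSeries.mk fun n => if n = 0 then 0 else freeCumulant ψ n fun _ => X

/-- The series `ᶜR_X(z) = ∑_{n ≥ 1} ᶜRⁿ(X, …, X) zⁿ`. -/
noncomputable def cRTransform (φ ψ : A →ₗ[ℂ] ℂ) (X : A) : ℂ⟦X⟧ :=
  PowerSeries.mk fun n => if n = 0 then 0 else cfreeCumulant φ ψ n fun _ => X

theorem sum_composition_split {n : ℕ} (f : Composition n → ℂ) :
    ∑ c, f c = f (Composition.ones n) + ∑ c : {c : Composition n // c.length < n}, f c.1 := by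
  classical
  rw [← Finset.add_sum_erase Finset.univ f (Finset.mem_univ (Composition.ones n))]
  congr 1
  refine Finset.sum_subtype _ (fun c => ?_) f
  simp only [Finset.mem_erase, Finset.mem_univ, and_true, ne_eq,
    Composition.eq_ones_iff_le_length, not_le]

theorem freeCumulant_heads_ones (ψ : A →ₗ[ℂ] ℂ) {n : ℕ} (a : Fin n → A) :
    freeCumulant ψ (Composition.ones n).length (heads (Composition.ones n) a)
      = freeCumulant ψ n a := by
  have key : ∀ (m : ℕ) (b : Fin m → A) (h : m = n), (∀ k : Fin m, b k = a (Fin.cast h k)) →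
      freeCumulant ψ m b = freeCumulant ψ n a := by
    rintro m b rfl hb
    congr 1
    funext k
    exact hb k
  refine key _ _ (Composition.ones_length n) fun k => ?_
  simp only [heads]
  rw [Composition.ones_embedding]
  rfl

theorem cfreeCumulant_heads_ones (φ ψ : A →ₗ[ℂ] ℂ) {n : ℕ} (a : Fin n → A) :
    cfreeCumulant φ ψ (Composition.ones n).length (heads (Composition.ones n) a)
      = cfreeCumulant φ ψ n a := by
  have key : ∀ (m : ℕ) (b : Fin m → A) (h : m = n), (∀ k : Fin m, b k = a (Fin.cast h k)) →
      cfreeCumulant φ ψ m b = cfreeCumulant φ ψ n a := by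
    rintro m b rfl hb
    congr 1
    funext k
    exact hb k
  refine key _ _ (Composition.ones_length n) fun k => ?_
  simp only [heads]
  rw [Composition.ones_embedding]
  rfl

/-- The defining recurrence of the free cumulants. -/
theorem moment_eq_sum_freeCumulant (ψ : A →ₗ[ℂ] ℂ) (hψ : ψ 1 = 1) {n : ℕ} (a : Fin n → A) :
    ψ (List.ofFn a).prod =
      ∑ c : Composition n, freeCumulant ψ c.length (heads c a) * ∏ k, ψ (gap c a k) := by
  rw [sum_composition_split, freeCumulant_heads_ones, freeCumulant.eq_def ψ n a]
  simp [gap_ones, hψ]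

/-- The defining recurrence of the c-free cumulants. -/
theorem moment_eq_sum_cfreeCumulant (φ ψ : A →ₗ[ℂ] ℂ) (hφ : φ 1 = 1) (hψ : ψ 1 = 1)
    {n : ℕ} (a : Fin n → A) :
    φ (List.ofFn a).prod =
      ∑ c : Composition n, cfreeCumulant φ ψ c.length (heads c a) *
        ∏ k : Fin c.length,
          if (k : ℕ) + 1 = c.length then φ (gap c a k) else ψ (gap c a k) := by
  rw [sum_composition_split, cfreeCumulant_heads_ones, cfreeCumulant.eq_def φ ψ n a]
  simp [gap_ones, hφ, hψ]

/-- The first coefficient of `R_X` is `ψ(X)`. -/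
theorem coeff_one_RTransform (ψ : A →ₗ[ℂ] ℂ) (X : A) :
    PowerSeries.coeff 1 (RTransform ψ X) = ψ X := by
  have : IsEmpty {c : Composition 1 // c.length < 1} := ⟨fun c => by
    have h1 := c.1.length_pos_iff.2 one_pos
    have h2 := c.2
    omega⟩
  rw [RTransform, PowerSeries.coeff_mk, if_neg one_ne_zero, freeCumulant.eq_def]
  simp

end Cumulants

section Partitions

/-- Partitions of the ordered set with `n` elements, `Fin n = {0, …, n - 1}`. The order of
`Finpartition` is: `π ≤ σ` if every block of `π` is contained in a block of `σ`. -/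
abbrev Part (n : ℕ) : Type := Finpartition (Finset.univ : Finset (Fin n))

/-- A collection of blocks has no crossing `i < j < k < l` with `i, k` in one block and `j, l`
in a different one. -/
def NonCrossing {α : Type*} [LinearOrder α] (P : Finset (Finset α)) : Prop :=
  ∀ B ∈ P, ∀ C ∈ P, ∀ i ∈ B, ∀ j ∈ C, ∀ k ∈ B, ∀ l ∈ C, i < j → j < k → k < l → B = C

/-- The blocks of `π ∪ σ`, where `π` is placed on the symbols `1 < ⋯ < n`, `σ` on
`1̄ < ⋯ < n̄`, and the symbols are ordered by `1 < 1̄ < 2 < 2̄ < ⋯ < n < n̄`: the symbol `i`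
is realized as the number `2 i`, the symbol `ī` as `2 i + 1`. -/
def interlace {n : ℕ} (π σ : Part n) : Finset (Finset ℕ) :=
  (π.parts.image fun B => B.image fun i : Fin n => 2 * (i : ℕ)) ∪
    (σ.parts.image fun B => B.image fun i : Fin n => 2 * (i : ℕ) + 1)

/-- `i` and `j` are equivalent if no block of `π` meets both the set of the elements `x` with
`min i j < x ≤ max i j` (those symbols that separate `ī` from `j̄`) and its complement. -/
def krewerasSetoid {n : ℕ} (π : Part n) : Setoid (Fin n) where
  r i j := ∀ B ∈ π.parts, ∀ x ∈ B, ∀ y ∈ B, ((i < x ↔ j < x) ↔ (i < y ↔ j < y))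
  iseqv :=
    { refl := fun i B _ x _ y _ => by tauto
      symm := fun h B hB x hx y hy => by have := h B hB x hx y hy; tauto
      trans := fun h h' B hB x hx y hy => by
        have h1 := h B hB x hx y hy
        have h2 := h' B hB x hx y hy
        tauto }

instance {n : ℕ} (π : Part n) : DecidableRel (krewerasSetoid π).r := fun i j =>
  inferInstanceAs (Decidable
    (∀ B ∈ π.parts, ∀ x ∈ B, ∀ y ∈ B, ((i < x ↔ j < x) ↔ (i < y ↔ j < y))))

/-- The Kreweras complement `Kr(π)`; see `isGreatest_kreweras` for its characterization as the
biggest non-crossing partition `σ` such that `π ∪ σ` is non-crossing. -/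
def kreweras {n : ℕ} (π : Part n) : Part n := Finpartition.ofSetoid (krewerasSetoid π)

theorem rel_of_mem_kreweras {n : ℕ} {π : Part n} {P : Finset (Fin n)}
    (hP : P ∈ (kreweras π).parts) {i j : Fin n} (hi : i ∈ P) (hj : j ∈ P) :
    (krewerasSetoid π).r i j := by
  have h : j ∈ (kreweras π).part i := by
    rw [(kreweras π).part_eq_of_mem hP hi]
    exact hj
  rw [kreweras, Finpartition.mem_part_ofSetoid_iff_rel] at h
  exact h

theorem nonCrossing_kreweras {n : ℕ} (π : Part n) : NonCrossing (kreweras π).parts := by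
  intro P hP Q hQ i hi j hj k hk l hl hij hjk hkl
  have hik := rel_of_mem_kreweras hP hi hk
  have hjl := rel_of_mem_kreweras hQ hj hl
  have hrel : (krewerasSetoid π).r i j := by
    intro B hB x hx y hy
    have h1 := hik B hB x hx y hy
    have h2 := hjl B hB x hx y hy
    grind
  have hmem : j ∈ (kreweras π).part i := by
    rw [kreweras, Finpartition.mem_part_ofSetoid_iff_rel]
    exact hrel
  rw [(kreweras π).part_eq_of_mem hP hi] at hmem
  exact (kreweras π).eq_of_mem_parts hP hQ hmem hj

theorem isGreatest_kreweras {n : ℕ} (π : Part n) (hπ : NonCrossing π.parts) :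
    IsGreatest {σ : Part n | NonCrossing σ.parts ∧ NonCrossing (interlace π σ)}
      (kreweras π) := by
  have hkr := nonCrossing_kreweras π
  refine ⟨⟨hkr, ?_⟩, ?_⟩
  · intro P hP Q hQ i hi j hj k hk l hl hij hjk hkl
    simp only [interlace, Finset.mem_union, Finset.mem_image] at hP hQ
    rcases hP with ⟨B, hB, rfl⟩ | ⟨B, hB, rfl⟩ <;> rcases hQ with ⟨C, hC, rfl⟩ | ⟨C, hC, rfl⟩ <;>
      simp only [Finset.mem_image] at hi hj hk hl <;>
      obtain ⟨i, hi, rfl⟩ := hi <;> obtain ⟨j, hj, rfl⟩ := hj <;>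
      obtain ⟨k, hk, rfl⟩ := hk <;> obtain ⟨l, hl, rfl⟩ := hl
    · rw [hπ B hB C hC i hi j hj k hk l hl (by omega) (by omega) (by omega)]
    · have := rel_of_mem_kreweras hC hj hl B hB i hi k hk
      simp only [Fin.lt_def] at this
      omega
    · have := rel_of_mem_kreweras hB hi hk C hC j hj l hl
      simp only [Fin.lt_def] at this
      omega
    · rw [hkr B hB C hC i hi j hj k hk l hl (by omega) (by omega) (by omega)]
  · rintro σ ⟨-, hσ⟩ B hB
    obtain ⟨b, hb⟩ := σ.nonempty_of_mem_parts hB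
    refine ⟨(kreweras π).part b, (kreweras π).part_mem.2 (Finset.mem_univ b), ?_⟩
    intro c hc
    rw [kreweras, Finpartition.mem_part_ofSetoid_iff_rel]
    have key : ∀ i ∈ B, ∀ k ∈ B, ∀ C ∈ π.parts, ∀ x ∈ C, ∀ y ∈ C,
        i < x → x ≤ k → (y ≤ i ∨ k < y) → False := by
      intro i hi k hk C hC x hx y hy h1 h2 h3
      have hBm : (B.image fun i : Fin n => 2 * (i : ℕ) + 1) ∈ interlace π σ :=
        Finset.mem_union_right _ (Finset.mem_image_of_mem _ hB)
      have hCm : (C.image fun i : Fin n => 2 * (i : ℕ)) ∈ interlace π σ :=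
        Finset.mem_union_left _ (Finset.mem_image_of_mem _ hC)
      have hne : (B.image fun i : Fin n => 2 * (i : ℕ) + 1) ≠
          (C.image fun i : Fin n => 2 * (i : ℕ)) := by
        intro h
        have : 2 * (i : ℕ) + 1 ∈ C.image fun i : Fin n => 2 * (i : ℕ) :=
          h ▸ Finset.mem_image_of_mem _ hi
        obtain ⟨z, -, hz⟩ := Finset.mem_image.1 this
        omega
      have mi := Finset.mem_image_of_mem (fun i : Fin n => 2 * (i : ℕ) + 1) hi
      have mk := Finset.mem_image_of_mem (fun i : Fin n => 2 * (i : ℕ) + 1) hk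
      have mx := Finset.mem_image_of_mem (fun i : Fin n => 2 * (i : ℕ)) hx
      have my := Finset.mem_image_of_mem (fun i : Fin n => 2 * (i : ℕ)) hy
      simp only [Fin.lt_def, Fin.le_def] at h1 h2 h3
      rcases h3 with h3 | h3
      · exact hne (hσ _ hCm _ hBm _ my _ mi _ mx _ mk (by omega) (by omega) (by omega)).symm
      · exact hne (hσ _ hBm _ hCm _ mi _ mx _ mk _ my (by omega) (by omega) (by omega))
    intro C hC x hx y hy
    have k1 := key b hb c hc C hC x hx y hy
    have k2 := key b hb c hc C hC y hy x hx
    have k3 := key c hc b hb C hC x hx y hy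
    have k4 := key c hc b hb C hC y hy x hx
    grind

open Classical in
/-- The set `NC(n)` of non-crossing partitions. -/
noncomputable def NC (n : ℕ) : Finset (Part n) :=
  Finset.univ.filter fun π => NonCrossing π.parts

/-- `Cf_π(f) = ∏_{B ∈ π} α_{|B|}` for `f(z) = ∑ αₙ zⁿ`. -/
noncomputable def Cf {n : ℕ} (f : ℂ⟦X⟧) (π : Part n) : ℂ :=
  ∏ B ∈ π.parts, PowerSeries.coeff B.card f

/-- The modified boxed convolution: the coefficient of `zⁿ`, `n ≥ 1`, is the sum of
`Cf_π(f) Cf_{Kr(π)}(g)` over those `π ∈ NC(n)` in which the first element is a block by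
itself. -/
noncomputable def modBoxConv (f g : ℂ⟦X⟧) : ℂ⟦X⟧ :=
  PowerSeries.mk fun n => match n with
    | 0 => 0
    | m + 1 => ∑ π ∈ NC (m + 1) with {(0 : Fin (m + 1))} ∈ π.parts,
        Cf f π * Cf g (kreweras π)

/-- `(1/z) f(z)` for a power series `f` without constant term. -/
noncomputable def divZ (f : ℂ⟦X⟧) : ℂ⟦X⟧ :=
  PowerSeries.mk fun n => PowerSeries.coeff (n + 1) f

theorem hasSubst_smul_modBoxConv (t : ℂ) (f g : ℂ⟦X⟧) :
    PowerSeries.HasSubst (t • modBoxConv f g) :=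
  PowerSeries.HasSubst.of_constantCoeff_zero' (by
    rw [← PowerSeries.coeff_zero_eq_constantCoeff_apply]
    simp [modBoxConv])

/-- The composition `f ∘ g`, for a power series `g` without constant term. -/
noncomputable def comp (f g : ℂ⟦X⟧) : ℂ⟦X⟧ := PowerSeries.subst g f

end Partitions

end CFree

namespace CFree

/-! ### Formal power series: substitution, series with coefficients in the algebra, resolvents. -/

section Series

/-! Write `F` and `G` for the two inner series `(1/α₁) R_X ⋆̌ R_Y` and `(1/β₁) R_Y ⋆̌ R_X`. The
proof has an algebraic half, which uses only that `F`, `G` solve a subordination system, and a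
combinatorial half, which derives that system.

Algebra. Suppose `F = z·(R_Y/z)∘G` and `G = z·(R_X/z)∘F`. Put `h = R_X∘F`; then `zh = FG` and also
`h = R_Y∘G`. With `u = F/(1+h)`, `v = G/(1+h)`, `w = z/(1+h)`, the moment-cumulant relation `M(t) =
1 + R(tM(t))` shows that the `ψ`-moment series of `X` at `u` and of `Y` at `v` both equal `1+h`. So
the resolvents are `a = (1-uX)⁻¹ = (1+h) + u a'` and `b = (1-vY)⁻¹ = (1+h) + v b'`, with `a'`, `b'`
centred. The resolvent of `XY` at `w` is then essentially a geometric series in `a'b'` framed by `b`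
and `a` (`resolvent_identity`). C-freeness evaluates a functional on each framed alternating word,
and the series can be summed (`extend_geom_mul`). For `ψ` this gives the value `1+h` for `XY` at
`w`. For `φ` it gives `h(1-1/P_XY) = (1+h)(1-1/P_X)(1-1/P_Y)`, where `P` denotes the `φ`-moment
series at `w`, `u`, `v`. Each `1-1/P` is the variable times `(ᶜR/z)` evaluated at `z`, `F`, `G`
respectively, and `uv(1+h) = wh` cancels the variables (`divZ_cRTransform_mul`).

Combinatorics. A pair `(π, Kr(π))` is encoded as one equivalence relation on an interval of
integers, even numbers carrying `π` and odd ones `Kr(π)`; dropping the block `{1}`, whose weight is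
cancelled by `1/α₁`, leaves an interval that begins and ends with an odd number. Cutting at the
second element of the class of the left end gives a smaller structure of opposite parity and one of
the same parity (`rootedSum_succ`). The resulting recursion of generating series solves to a
substitution, which is the subordination system (`smul_modBoxConv_eq_X_mul_subst`). -/

theorem eq_of_forall_X_pow_dvd {f g : ℂ⟦X⟧}
    (h : ∀ k : ℕ, (PowerSeries.X : ℂ⟦X⟧) ^ k ∣ f - g) : f = g := by
  rw [← sub_eq_zero]
  ext n
  exact PowerSeries.X_pow_dvd_iff.1 (h (n + 1)) n (Nat.lt_succ_self n)

theorem mk_eq_C_add_X_mul (a : ℕ → ℂ) :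
    PowerSeries.mk a =
      PowerSeries.C (a 0) + PowerSeries.X * PowerSeries.mk fun n => a (n + 1) := by
  ext n
  cases n with
  | zero => simp
  | succ n => simp [PowerSeries.coeff_succ_X_mul]

theorem subst_mk_eq (a : ℕ → ℂ) {t : ℂ⟦X⟧} (ht : PowerSeries.constantCoeff t = 0) :
    (PowerSeries.mk a).subst t =
      PowerSeries.C (a 0) + t * (PowerSeries.mk fun n => a (n + 1)).subst t := by
  have hs : PowerSeries.HasSubst t := PowerSeries.HasSubst.of_constantCoeff_zero' ht
  conv_lhs => rw [mk_eq_C_add_X_mul a]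
  rw [PowerSeries.subst_add hs, PowerSeries.subst_mul hs, PowerSeries.subst_X hs,
    PowerSeries.subst_C]
  rfl

/-- A family of series indexed by sequences which satisfies a first-step recursion is given by
substitution. -/
theorem eq_mul_subst_of_recursion (P : (ℕ → ℂ) → ℂ⟦X⟧) {t t' : ℂ⟦X⟧}
    (ht : PowerSeries.constantCoeff t = 0)
    (h : ∀ a, P a = PowerSeries.C (a 0) * t' + t * P fun n => a (n + 1)) (a : ℕ → ℂ) :
    P a = t' * (PowerSeries.mk a).subst t := by
  apply eq_of_forall_X_pow_dvd
  have hX : (PowerSeries.X : ℂ⟦X⟧) ∣ t := PowerSeries.X_dvd_iff.2 ht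
  intro k
  induction k generalizing a with
  | zero => simp
  | succ k ih =>
    rw [h a, subst_mk_eq a ht]
    have : PowerSeries.C (a 0) * t' + t * P (fun n => a (n + 1)) -
        t' * (PowerSeries.C (a 0) + t * (PowerSeries.mk fun n => a (n + 1)).subst t) =
        t * (P (fun n => a (n + 1)) - t' * (PowerSeries.mk fun n => a (n + 1)).subst t) := by
      ring
    rw [this, pow_succ']
    exact mul_dvd_mul hX (ih _)

/-- The sum `∑ cₖ tᵏ` for coefficients `cₖ` in an algebra and a series `t` without constant
term. -/
noncomputable def ser {A : Type*} [Ring A] [Algebra ℂ A] (c : ℕ → A) (t : ℂ⟦X⟧) : A⟦X⟧ :=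
  PowerSeries.mk fun n => ∑ k ∈ Finset.range (n + 1), PowerSeries.coeff n (t ^ k) • c k

theorem coeff_pow_eq_zero {t : ℂ⟦X⟧} (ht : PowerSeries.constantCoeff t = 0) {n k : ℕ}
    (h : n < k) : PowerSeries.coeff n (t ^ k) = 0 :=
  PowerSeries.X_pow_dvd_iff.1 (pow_dvd_pow_of_dvd (PowerSeries.X_dvd_iff.2 ht) k) n h

theorem coeff_ser {A : Type*} [Ring A] [Algebra ℂ A] (c : ℕ → A) {t : ℂ⟦X⟧}
    (ht : PowerSeries.constantCoeff t = 0) {n N : ℕ} (h : n < N) :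
    PowerSeries.coeff n (ser c t) =
      ∑ k ∈ Finset.range N, PowerSeries.coeff n (t ^ k) • c k := by
  rw [ser, PowerSeries.coeff_mk]
  refine Finset.sum_subset (Finset.range_mono h) fun k _ hk => ?_
  rw [coeff_pow_eq_zero ht (by simpa using hk), zero_smul]

/-- The embedding of scalar series. -/
noncomputable def scalarSeries (A : Type*) [Ring A] [Algebra ℂ A] : ℂ⟦X⟧ →+* A⟦X⟧ :=
  PowerSeries.map (algebraMap ℂ A)

theorem scalarSeries_commutes {A : Type*} [Ring A] [Algebra ℂ A] (t : ℂ⟦X⟧) (x : A⟦X⟧) :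
    scalarSeries A t * x = x * scalarSeries A t := by
  ext n
  rw [PowerSeries.coeff_mul, PowerSeries.coeff_mul, ← Finset.Nat.sum_antidiagonal_swap]
  refine Finset.sum_congr rfl fun p _ => ?_
  simp only [scalarSeries, PowerSeries.coeff_map]
  exact Algebra.commutes _ _

/-- Series over an algebra form an algebra over the scalar series. -/
@[reducible]
noncomputable def seriesAlgebra (A : Type*) [Ring A] [Algebra ℂ A] : Algebra ℂ⟦X⟧ A⟦X⟧ :=
  (scalarSeries A).toAlgebra' scalarSeries_commutes

attribute [local instance] seriesAlgebra

theorem series_smul_def {A : Type*} [Ring A] [Algebra ℂ A] (t : ℂ⟦X⟧) (x : A⟦X⟧) :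
    t • x = scalarSeries A t * x := rfl

theorem coeff_series_smul {A : Type*} [Ring A] [Algebra ℂ A] (t : ℂ⟦X⟧) (x : A⟦X⟧) (n : ℕ) :
    PowerSeries.coeff n (t • x) =
      ∑ p ∈ Finset.HasAntidiagonal.antidiagonal n,
        PowerSeries.coeff p.1 t • PowerSeries.coeff p.2 x := by
  rw [series_smul_def, PowerSeries.coeff_mul]
  refine Finset.sum_congr rfl fun p _ => ?_
  rw [scalarSeries, PowerSeries.coeff_map, Algebra.smul_def]

/-- The coefficientwise extension of a linear functional to series. -/
noncomputable def extend {A : Type*} [Ring A] [Algebra ℂ A] (φ : A →ₗ[ℂ] ℂ) :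
    A⟦X⟧ →ₗ[ℂ⟦X⟧] ℂ⟦X⟧ where
  toFun x := PowerSeries.mk fun n => φ (PowerSeries.coeff n x)
  map_add' x y := by ext n; simp
  map_smul' t x := by
    ext n
    rw [PowerSeries.coeff_mk, coeff_series_smul, map_sum, RingHom.id_apply, smul_eq_mul,
      PowerSeries.coeff_mul]
    simp

theorem coeff_extend {A : Type*} [Ring A] [Algebra ℂ A] (φ : A →ₗ[ℂ] ℂ) (x : A⟦X⟧) (n : ℕ) :
    PowerSeries.coeff n (extend φ x) = φ (PowerSeries.coeff n x) :=
  PowerSeries.coeff_mk n fun n => φ (PowerSeries.coeff n x)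

theorem extend_one {A : Type*} [Ring A] [Algebra ℂ A] {φ : A →ₗ[ℂ] ℂ} (hφ : φ 1 = 1) :
    extend φ 1 = 1 := by
  ext n
  rw [coeff_extend, PowerSeries.coeff_one, PowerSeries.coeff_one]
  split_ifs <;> simp [hφ]

variable {A : Type*} [Ring A] [Algebra ℂ A]

theorem smul_ser_succ (c : ℕ → A) {t : ℂ⟦X⟧} (ht : PowerSeries.constantCoeff t = 0) :
    t • ser (fun k => c (k + 1)) t = ser c t - PowerSeries.C (c 0) := by
  ext n
  rw [coeff_series_smul, map_sub, coeff_ser c ht (show n < n + 2 by omega),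
    Finset.sum_range_succ']
  have h0 : PowerSeries.coeff n (PowerSeries.C (c 0) : A⟦X⟧) =
      PowerSeries.coeff n (t ^ 0) • c 0 := by
    rw [pow_zero, PowerSeries.coeff_C, PowerSeries.coeff_one]
    split_ifs <;> simp
  rw [h0, add_sub_cancel_right]
  have h1 : ∀ p ∈ Finset.HasAntidiagonal.antidiagonal n,
      PowerSeries.coeff p.1 t • PowerSeries.coeff p.2 (ser (fun k => c (k + 1)) t) =
      ∑ k ∈ Finset.range (n + 1),
        (PowerSeries.coeff p.1 t * PowerSeries.coeff p.2 (t ^ k)) • c (k + 1) := by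
    intro p hp
    rw [coeff_ser _ ht (show p.2 < n + 1 by
      have := Finset.HasAntidiagonal.mem_antidiagonal.1 hp; omega), Finset.smul_sum]
    simp only [mul_smul]
  rw [Finset.sum_congr rfl h1, Finset.sum_comm]
  refine Finset.sum_congr rfl fun k _ => ?_
  rw [← Finset.sum_smul, pow_succ', PowerSeries.coeff_mul]

theorem extend_ser (φ : A →ₗ[ℂ] ℂ) (c : ℕ → A) (t : ℂ⟦X⟧) :
    extend φ (ser c t) = ser (fun k => φ (c k)) t := by
  ext n
  simp [coeff_extend, ser]

theorem ser_eq_subst (c : ℕ → ℂ) {t : ℂ⟦X⟧} (ht : PowerSeries.constantCoeff t = 0) :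
    ser c t = (PowerSeries.mk c).subst t := by
  rw [← one_mul (PowerSeries.subst _ _)]
  refine eq_mul_subst_of_recursion (fun c => ser c t) ht (fun a => ?_) c
  have h := smul_ser_succ a ht
  rw [series_smul_def, scalarSeries, Algebra.algebraMap_self, PowerSeries.map_id,
    id_eq] at h
  rw [h]
  ring

theorem ser_sub (c d : ℕ → A) (t : ℂ⟦X⟧) : ser (fun k => c k - d k) t = ser c t - ser d t := by
  ext n
  simp [ser, smul_sub]

theorem C_mul_ser (x : A) (c : ℕ → A) (t : ℂ⟦X⟧) :
    PowerSeries.C x * ser c t = ser (fun k => x * c k) t := by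
  ext n
  simp [ser, Finset.mul_sum]

theorem ser_mul_C (x : A) (c : ℕ → A) (t : ℂ⟦X⟧) :
    ser c t * PowerSeries.C x = ser (fun k => c k * x) t := by
  ext n
  simp [ser, Finset.sum_mul]

theorem ser_algebraMap (c : ℕ → ℂ) (t : ℂ⟦X⟧) :
    ser (fun k => algebraMap ℂ A (c k)) t = ser c t • (1 : A⟦X⟧) := by
  rw [series_smul_def, mul_one]
  ext n
  simp [ser, scalarSeries, Algebra.smul_def]

/-- The geometric series is the resolvent `(1 - t x)⁻¹`; since `A` need not be commutative, both
one-sided identities are recorded. -/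
theorem one_sub_smul_mul_geom (x : A) {t : ℂ⟦X⟧} (ht : PowerSeries.constantCoeff t = 0) :
    (1 - t • (PowerSeries.C x : A⟦X⟧)) * ser (fun k => x ^ k) t = 1 := by
  have h := smul_ser_succ (fun k => x ^ k) ht
  rw [sub_mul, one_mul, smul_mul_assoc, C_mul_ser]
  simp only [pow_succ', pow_zero, map_one] at h
  rw [h]
  abel

theorem geom_mul_one_sub_smul (x : A) {t : ℂ⟦X⟧} (ht : PowerSeries.constantCoeff t = 0) :
    ser (fun k => x ^ k) t * (1 - t • (PowerSeries.C x : A⟦X⟧)) = 1 := by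
  have h := smul_ser_succ (fun k => x ^ k) ht
  rw [mul_sub, mul_one, mul_smul_comm, ser_mul_C]
  simp only [pow_succ, pow_zero, map_one] at h
  rw [h]
  abel

/-- The generating series of the moments of `T`. -/
noncomputable def momentSeries (φ : A →ₗ[ℂ] ℂ) (T : A) : ℂ⟦X⟧ :=
  PowerSeries.mk fun k => φ (T ^ k)

theorem extend_geom (φ : A →ₗ[ℂ] ℂ) (T : A) {t : ℂ⟦X⟧}
    (ht : PowerSeries.constantCoeff t = 0) :
    extend φ (ser (fun k => T ^ k) t) = (momentSeries φ T).subst t := by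
  rw [extend_ser, ser_eq_subst _ ht, momentSeries]

end Series

/-! ### Sums over compositions as substitutions. -/

section Compositions

/-- Prepend a block to a composition. -/
def consComposition {n : ℕ} (i : Fin (n + 1)) (c : Composition (n - i)) :
    Composition (n + 1) where
  blocks := (i + 1) :: c.blocks
  blocks_pos := by
    intro j hj
    rcases List.mem_cons.1 hj with rfl | h
    · omega
    · exact c.blocks_pos h
  blocks_sum := by
    rw [List.sum_cons, c.blocks_sum]
    omega

theorem consComposition_bijective (n : ℕ) :
    Function.Bijective fun p : Σ i : Fin (n + 1), Composition (n - i) =>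
      consComposition p.1 p.2 := by
  constructor
  · rintro ⟨i, c⟩ ⟨j, d⟩ h
    have h' := congrArg Composition.blocks h
    simp only [consComposition, List.cons.injEq, add_left_inj] at h'
    obtain rfl : i = j := Fin.ext h'.1
    rw [Composition.ext h'.2]
  · intro c
    rcases hb : c.blocks with _ | ⟨x, l⟩
    · exact absurd (c.blocks_eq_nil.1 hb) (Nat.succ_ne_zero n)
    · have hx : 0 < x := c.blocks_pos (by simp [hb])
      have hs := c.blocks_sum
      rw [hb, List.sum_cons] at hs
      refine ⟨⟨⟨x - 1, by omega⟩, ⟨l, fun {i} hi => c.blocks_pos (by simp [hb, hi]), ?_⟩⟩, ?_⟩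
      · simp only
        omega
      · apply Composition.ext
        simp only [consComposition, hb, List.cons.injEq, and_true]
        omega

theorem sum_composition_succ (n : ℕ) (f : List ℕ → ℂ) :
    ∑ c : Composition (n + 1), f c.blocks =
      ∑ i ∈ Finset.range (n + 1), ∑ c : Composition (n - i), f ((i + 1) :: c.blocks) := by
  rw [← (consComposition_bijective n).sum_comp fun c => f c.blocks, Fintype.sum_sigma,
    Finset.sum_range]
  rfl

/-- The product of the values of `y'` at the last entry and of `y` at the other entries. -/
def lastProd (y y' : ℕ → ℂ) : List ℕ → ℂ
  | [] => 1
  | [x] => y' x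
  | x :: x' :: l => y x * lastProd y y' (x' :: l)

theorem prod_eq_lastProd (y y' : ℕ → ℂ) (l : List ℕ) :
    (∏ k : Fin l.length, if (k : ℕ) + 1 = l.length then y' (l.get k) else y (l.get k)) =
      lastProd y y' l := by
  induction l with
  | nil => simp [lastProd]
  | cons x l ih =>
    cases l with
    | nil => simp [lastProd]
    | cons x' l =>
      rw [lastProd, ← ih]
      simp only [List.length_cons]
      rw [Fin.prod_univ_succ]
      simp

/-- A sum over compositions, weighted by the number of blocks and by the sizes of the blocks, as
the coefficient of a substitution. -/
theorem mk_sum_composition (y y' : ℕ → ℂ) (a : ℕ → ℂ) :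
    (PowerSeries.mk fun n => if n = 0 then 0 else
        ∑ c : Composition n, a (c.blocks.length - 1) * lastProd y y' c.blocks) =
      (PowerSeries.X * PowerSeries.mk fun k => y' (k + 1)) *
        (PowerSeries.mk a).subst (PowerSeries.X * PowerSeries.mk fun k => y (k + 1)) := by
  refine eq_mul_subst_of_recursion (fun a => PowerSeries.mk fun n => if n = 0 then 0 else
    ∑ c : Composition n, a (c.blocks.length - 1) * lastProd y y' c.blocks) (by simp)
    (fun a => ?_) a
  ext n
  cases n with
  | zero => simp
  | succ n =>
    rw [mul_left_comm, mul_assoc, ← mul_add, PowerSeries.coeff_succ_X_mul, map_add,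
      PowerSeries.coeff_C_mul, PowerSeries.coeff_mk, PowerSeries.coeff_mk,
      if_neg (Nat.succ_ne_zero n), PowerSeries.coeff_mul,
      Finset.Nat.sum_antidiagonal_eq_sum_range_succ_mk, Finset.sum_range_succ,
      sum_composition_succ n fun l => a (l.length - 1) * lastProd y y' l,
      Finset.sum_range_succ, add_comm]
    congr 1
    -- The term `i = n` is the composition with a single block, which is its own last block and so
    -- carries `y'`.
    · rw [Nat.sub_self]
      have : ∀ c : Composition 0, c.blocks = [] := fun c => c.blocks_eq_nil.2 rfl
      simp [this, lastProd, composition_card]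
    · simp only [Nat.sub_self, PowerSeries.coeff_mk, if_true, mul_zero, add_zero]
      refine Finset.sum_congr rfl fun i hi => ?_
      have hi : i < n := Finset.mem_range.1 hi
      rw [if_neg (by omega), Finset.mul_sum]
      refine Finset.sum_congr rfl fun c _ => ?_
      rcases hb : c.blocks with _ | ⟨x, l⟩
      · have := c.blocks_eq_nil.1 hb
        omega
      · simp only [lastProd, List.length_cons, Nat.add_sub_cancel]
        ring

end Compositions

/-! ### Moment-cumulant relations for one element. -/

section SingleVariable

theorem gap_const {A : Type*} [Ring A] {n : ℕ} (c : Composition n) (T : A) (k : Fin c.length) :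
    gap c (fun _ => T) k = T ^ (c.blocks.get k - 1) := by
  rw [gap, List.ofFn_const, List.tail_replicate, List.prod_replicate]
  rfl

variable {A : Type*} [Ring A] [Algebra ℂ A]

/-- The moment series in terms of the c-free cumulants. -/
theorem momentSeries_eq (φ ψ : A →ₗ[ℂ] ℂ) (hφ : φ 1 = 1) (hψ : ψ 1 = 1) (T : A) :
    momentSeries φ T = 1 + PowerSeries.X * momentSeries φ T *
      (divZ (cRTransform φ ψ T)).subst (PowerSeries.X * momentSeries ψ T) := by
  -- A block of size `n` is its head followed by a gap of `n - 1` letters; only the gap of the last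
  -- block is evaluated with `φ`.
  have h := mk_sum_composition (fun n => ψ (T ^ (n - 1))) (fun n => φ (T ^ (n - 1)))
    (fun n => cfreeCumulant φ ψ (n + 1) fun _ => T)
  have hd : divZ (cRTransform φ ψ T) =
      PowerSeries.mk fun n => cfreeCumulant φ ψ (n + 1) fun _ => T := by
    ext n
    simp [divZ, cRTransform]
  rw [hd, momentSeries, momentSeries]
  simp only [Nat.add_sub_cancel] at h
  rw [← h]
  ext n
  cases n with
  | zero => simp [hφ]
  | succ n =>
    have hm := moment_eq_sum_cfreeCumulant φ ψ hφ hψ (fun _ : Fin (n + 1) => T)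
    rw [List.ofFn_const, List.prod_replicate] at hm
    rw [PowerSeries.coeff_mk, hm, map_add, PowerSeries.coeff_one, if_neg (Nat.succ_ne_zero n),
      zero_add, PowerSeries.coeff_mk, if_neg (Nat.succ_ne_zero n)]
    refine Finset.sum_congr rfl fun c _ => ?_
    rw [← prod_eq_lastProd]
    have hl : c.blocks.length - 1 + 1 = c.length := by
      have := c.length_pos_iff.2 (Nat.succ_pos n)
      have := c.blocks_length
      omega
    rw [hl]
    simp only [gap_const]
    rfl

theorem cfreeCumulant_self (ψ : A →ₗ[ℂ] ℂ) (n : ℕ) (a : Fin n → A) :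
    cfreeCumulant ψ ψ n a = freeCumulant ψ n a := by
  induction n using Nat.strong_induction_on with
  | _ n ih =>
    rw [cfreeCumulant, freeCumulant]
    congr 1
    refine Finset.sum_congr rfl fun c _ => ?_
    rw [ih _ c.2]
    simp

theorem cRTransform_self (ψ : A →ₗ[ℂ] ℂ) (T : A) : cRTransform ψ ψ T = RTransform ψ T := by
  simp only [cRTransform, RTransform, cfreeCumulant_self]

end SingleVariable

/-! ### Evaluation of alternating words of series. -/

section Words

variable {A : Type*} [Ring A] [Algebra ℂ A]

attribute [local instance] seriesAlgebra

theorem CondFreeSubalgebras.apply_list {φ ψ : A →ₗ[ℂ] ℂ} {ι : Type*} {S : ι → Subalgebra ℂ A}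
    (h : CondFreeSubalgebras φ ψ S) (hφ : φ 1 = 1) (l : List (ι × A))
    (hS : ∀ p ∈ l, p.2 ∈ S p.1 ∧ ψ p.2 = 0) (hc : l.IsChain fun p q => p.1 ≠ q.1) :
    φ (l.map Prod.snd).prod = (l.map fun p => φ p.2).prod := by
  rcases hl : l.length with _ | n
  · rw [List.length_eq_zero_iff.1 hl]
    simpa using hφ
  · obtain ⟨f, rfl⟩ : ∃ f : Fin (n + 1) → ι × A, l = List.ofFn f := by
      refine ⟨fun i => l.get (Fin.cast hl.symm i), ?_⟩
      refine List.ext_getElem (by rw [List.length_ofFn, hl]) fun i h1 h2 => ?_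
      rw [List.getElem_ofFn]
      rfl
    have := (h n (fun i => (f i).1) (fun i => (f i).2)
      (fun j => (hS (f j) (List.mem_ofFn.2 ⟨j, rfl⟩)).1) (fun j => ?_)
      (fun j => (hS (f j) (List.mem_ofFn.2 ⟨j, rfl⟩)).2)).2
    · rw [List.map_ofFn, List.map_ofFn, List.prod_ofFn (f := (fun p => φ p.2) ∘ f)]
      exact this
    · have := List.isChain_iff_getElem.1 hc j (by simp)
      simp only [List.getElem_ofFn] at this
      exact this

/-- `φ` is multiplicative on alternating words of series with centred coefficients. -/
theorem CondFreeSubalgebras.extend_prod {φ ψ : A →ₗ[ℂ] ℂ} {ι : Type*}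
    {S : ι → Subalgebra ℂ A} (h : CondFreeSubalgebras φ ψ S) (hφ : φ 1 = 1)
    (l : List (ι × A⟦X⟧))
    (hS : ∀ p ∈ l, ∀ n, PowerSeries.coeff n p.2 ∈ S p.1 ∧ ψ (PowerSeries.coeff n p.2) = 0)
    (hc : l.IsChain fun p q => p.1 ≠ q.1) :
    extend φ (l.map Prod.snd).prod = (l.map fun p => extend φ p.2).prod := by
  -- Strengthening for the induction: the prefix `w` collects one coefficient from each series
  -- already expanded. Only the labels matter for alternation, so the chain condition is stated on
  -- them.
  suffices H : ∀ w : List (ι × A), (∀ p ∈ w, p.2 ∈ S p.1 ∧ ψ p.2 = 0) →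
      ((w.map Prod.fst) ++ (l.map Prod.fst)).IsChain (· ≠ ·) →
      extend φ (PowerSeries.C (w.map Prod.snd).prod * (l.map Prod.snd).prod) =
        PowerSeries.C (w.map fun p => φ p.2).prod * (l.map fun p => extend φ p.2).prod by
    simpa using H [] (by simp) (by simpa [List.isChain_map] using hc)
  clear hc
  induction l with
  | nil =>
    intro w hw hc
    have := h.apply_list hφ w hw (by simpa [List.isChain_map] using hc)
    simp only [List.map_nil, List.prod_nil, mul_one, ← this]
    ext n
    rw [coeff_extend, PowerSeries.coeff_C, PowerSeries.coeff_C]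
    split_ifs <;> simp
  | cons p l ih =>
    intro w hw hc
    ext n
    simp only [List.map_cons, List.prod_cons]
    rw [coeff_extend, ← mul_assoc, PowerSeries.coeff_mul, map_sum,
      mul_left_comm, PowerSeries.coeff_mul]
    refine Finset.sum_congr rfl fun q _ => ?_
    have := congrArg (PowerSeries.coeff q.2) (ih (fun p' hp' => hS p' (by simp [hp']))
      (w ++ [(p.1, PowerSeries.coeff q.1 p.2)]) (by
        intro p' hp'
        rcases List.mem_append.1 hp' with h' | h'
        · exact hw _ h'
        · rw [List.mem_singleton.1 h']
          exact hS p (by simp) _) (by simpa using hc))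
    rw [coeff_extend, PowerSeries.coeff_C_mul, PowerSeries.coeff_C_mul] at this
    rw [PowerSeries.coeff_C_mul, PowerSeries.coeff_C_mul, coeff_extend]
    simp only [List.map_append, List.map_cons, List.map_nil, List.prod_append,
      List.prod_singleton] at this
    rw [this]
    ring

theorem extend_alternating {φ ψ : A →ₗ[ℂ] ℂ} {S : Fin 2 → Subalgebra ℂ A}
    (h : CondFreeSubalgebras φ ψ S) (hφ : φ 1 = 1) {a b : A⟦X⟧}
    (ha : ∀ n, PowerSeries.coeff n a ∈ S 0 ∧ ψ (PowerSeries.coeff n a) = 0)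
    (hb : ∀ n, PowerSeries.coeff n b ∈ S 1 ∧ ψ (PowerSeries.coeff n b) = 0) (k : ℕ) :
    extend φ ((a * b) ^ k) = (extend φ a * extend φ b) ^ k ∧
    extend φ ((a * b) ^ k * a) = (extend φ a * extend φ b) ^ k * extend φ a ∧
    extend φ (b * (a * b) ^ k) = extend φ b * (extend φ a * extend φ b) ^ k ∧
    extend φ (b * (a * b) ^ k * a) =
      extend φ b * (extend φ a * extend φ b) ^ k * extend φ a := by
  let w : ℕ → List (Fin 2 × A⟦X⟧) := fun k => (List.replicate k [(0, a), (1, b)]).flatten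
  have hw0 : ∀ k, w (k + 1) = (0, a) :: (1, b) :: w k := fun k => by
    simp [w, List.replicate_succ]
  have hmem : ∀ k, ∀ p ∈ w k, p = (0, a) ∨ p = (1, b) := by
    intro k p hp
    simp only [w, List.mem_flatten, List.mem_replicate] at hp
    obtain ⟨l, ⟨-, rfl⟩, hp⟩ := hp
    simpa using hp
  have hS : ∀ p : Fin 2 × A⟦X⟧, p = (0, a) ∨ p = (1, b) →
      ∀ n, PowerSeries.coeff n p.2 ∈ S p.1 ∧ ψ (PowerSeries.coeff n p.2) = 0 := by
    rintro p (rfl | rfl) n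
    · exact ha n
    · exact hb n
  have hprod : ∀ (F : Fin 2 × A⟦X⟧ → ℂ⟦X⟧) k,
      ((w k).map F).prod = (F (0, a) * F (1, b)) ^ k := by
    intro F k
    simp [w, List.prod_flatten, List.map_flatten]
  have hprod' : ∀ k, ((w k).map Prod.snd).prod = (a * b) ^ k := by
    intro k
    simp [w, List.prod_flatten, List.map_flatten]
  -- The four words of the statement are all infixes of the longest one, `b (ab)^k a`, so one chain
  -- condition serves them all.
  have hch : ∀ k, ((1, b) :: (w k ++ [((0 : Fin 2), a)])).IsChain fun p q => p.1 ≠ q.1 := by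
    intro k
    induction k with
    | zero => simp [w]
    | succ k ih =>
      rw [hw0]
      refine List.IsChain.cons_cons (by simp) (List.IsChain.cons_cons (by simp) ih)
  have key : ∀ l : List (Fin 2 × A⟦X⟧), l <:+: ((1, b) :: (w k ++ [((0 : Fin 2), a)])) →
      extend φ (l.map Prod.snd).prod = (l.map fun p => extend φ p.2).prod := by
    intro l hl
    refine h.extend_prod hφ l (fun p hp => hS p ?_) ((hch k).infix hl)
    have := hl.subset hp
    simp only [List.mem_cons, List.mem_append, List.not_mem_nil, or_false] at this
    rcases this with h' | h' | h'
    · exact Or.inr h'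
    · exact hmem k p h'
    · exact Or.inl h'
  refine ⟨?_, ?_, ?_, ?_⟩
  · have := key (w k) ⟨[(1, b)], [(0, a)], by simp⟩
    rwa [hprod', hprod] at this
  · have := key (w k ++ [(0, a)]) ⟨[(1, b)], [], by simp⟩
    simpa [hprod', hprod] using this
  · have := key ((1, b) :: w k) ⟨[], [(0, a)], by simp⟩
    simpa [hprod', hprod] using this
  · have := key ((1, b) :: (w k ++ [(0, a)])) ⟨[], [], by simp⟩
    simpa [hprod', hprod, mul_assoc] using this

theorem smul_one_add_mul_mul_smul_one_add {K B : Type*} [CommRing K] [Ring B] [Algebra K B]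
    (e u v : K) (a b w : B) :
    (e • (1 : B) + v • b) * w * (e • (1 : B) + u • a) =
      (e * e) • w + (e * u) • (w * a) + (v * e) • (b * w) + (v * u) • (b * w * a) := by
  simp only [add_mul, mul_add, smul_mul_assoc, mul_smul_comm, one_mul, mul_one]
  module

/-- The value of `φ` on an alternating word framed by letters that are not centred. -/
theorem extend_framed {φ ψ : A →ₗ[ℂ] ℂ} {S : Fin 2 → Subalgebra ℂ A}
    (h : CondFreeSubalgebras φ ψ S) (hφ : φ 1 = 1) {a b a' b' : A⟦X⟧} {e u v : ℂ⟦X⟧}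
    (ha' : ∀ n, PowerSeries.coeff n a' ∈ S 0 ∧ ψ (PowerSeries.coeff n a') = 0)
    (hb' : ∀ n, PowerSeries.coeff n b' ∈ S 1 ∧ ψ (PowerSeries.coeff n b') = 0)
    (ha : a = e • (1 : A⟦X⟧) + u • a') (hb : b = e • (1 : A⟦X⟧) + v • b') (k : ℕ) :
    extend φ (b * (a' * b') ^ k * a) =
      extend φ a * extend φ b * (extend φ a' * extend φ b') ^ k := by
  obtain ⟨h1, h2, h3, h4⟩ := extend_alternating h hφ ha' hb' k
  have hexp : b * (a' * b') ^ k * a = (e * e) • (a' * b') ^ k + (e * u) • ((a' * b') ^ k * a')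
      + (v * e) • (b' * (a' * b') ^ k) + (v * u) • (b' * (a' * b') ^ k * a') := by
    rw [ha, hb, smul_one_add_mul_mul_smul_one_add]
  rw [hexp, ha, hb]
  simp only [map_add, map_smul, h1, h2, h3, h4, extend_one hφ, smul_eq_mul]
  ring

end Words

/-! ### The resolvent of a product as a geometric series. -/

section Resolvents

/-- With `G = (1 - vy) N (1 - ux)`, the element `a (1 - z xy) b` is a left inverse of `G`. Both `a
xy b` and `a'b'` become polynomials in `a` and `b` after multiplication by `zh`, and `huv` is the
condition under which they combine to the stated relation. The factor `h` remains because `zh`, not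
`z`, is what `uv` determines. -/
theorem resolvent_identity {K B : Type*} [CommRing K] [Ring B] [Algebra K B] {h z u v : K}
    {x y a b N a' b' : B} (ha2 : a * (1 - u • x) = 1)
    (hb : b * (1 - v • y) = 1) (hb2 : (1 - v • y) * b = 1)
    (hN : (1 - z • (x * y)) * N = 1)
    (haa : a = (1 + h) • (1 : B) + u • a') (hbb : b = (1 + h) • (1 : B) + v • b')
    (huv : u * v * (1 + h) = z * h) :
    (h * (1 + h) ^ 2) • ((1 - v • y) * N * (1 - u • x)) =
      (h * (1 + h)) • (1 : B) + (z * h) • (a' * b' * ((1 - v • y) * N * (1 - u • x))) := by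
  have hx : u • (a * x) = a - 1 := by
    rw [mul_sub, mul_one, mul_smul_comm] at ha2
    rw [← ha2]; abel
  have hy : v • (y * b) = b - 1 := by
    rw [sub_mul, one_mul, smul_mul_assoc] at hb2
    rw [← hb2]; abel
  have hua : u • a' = a - (1 + h) • (1 : B) := by rw [haa]; abel
  have hvb : v • b' = b - (1 + h) • (1 : B) := by rw [hbb]; abel
  have h1 : (z * h) • (a * (x * y) * b) = (1 + h) • ((a - 1) * (b - 1)) := by
    rw [← hx, ← hy, ← huv, smul_mul_smul_comm, smul_smul]
    simp only [mul_assoc]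
    congr 1
    ring
  have h2 : (z * h) • (a' * b') =
      (1 + h) • ((a - (1 + h) • (1 : B)) * (b - (1 + h) • (1 : B))) := by
    rw [← hua, ← hvb, ← huv, smul_mul_smul_comm, smul_smul]
    congr 1
    ring
  -- After `h1` and `h2` both sides are polynomials in `a`, `b` whose coefficients agree;
  -- multiplying by `G` on the right then gives the claim.
  have hE : (h * (1 + h) ^ 2) • (1 : B) - (z * h) • (a' * b') =
      (h * (1 + h)) • (a * (1 - z • (x * y)) * b) := by
    have h3 : (h * (1 + h)) • (a * (1 - z • (x * y)) * b) =
        (h * (1 + h)) • (a * b) - (1 + h) • ((z * h) • (a * (x * y) * b)) := by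
      simp only [mul_sub, sub_mul, mul_one, mul_smul_comm, smul_mul_assoc]
      module
    rw [h3, h1, h2]
    simp only [mul_sub, sub_mul, mul_one, one_mul, mul_smul_comm, smul_mul_assoc]
    module
  have hG : a * (1 - z • (x * y)) * b * ((1 - v • y) * N * (1 - u • x)) = 1 := by
    calc _ = a * ((1 - z • (x * y)) * (b * (1 - v • y)) * N) * (1 - u • x) := by
          simp only [mul_assoc]
      _ = 1 := by rw [hb, mul_one, hN, mul_one, ha2]
  generalize (1 - v • y) * N * (1 - u • x) = G at hG ⊢
  have := congrArg (· * G) hE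
  simp only [sub_mul (_ • (1 : B)), smul_mul_assoc, hG, one_mul] at this
  rw [← this]
  abel

/-- A sequence of series with a first-step recursion of geometric type. -/
theorem solve_geometric_recursion {g : ℕ → ℂ⟦X⟧} {z s e c : ℂ⟦X⟧}
    (hz : PowerSeries.constantCoeff z = 0) (he : IsUnit e)
    (hg : ∀ k, e * g k = c * s ^ k + z * g (k + 1)) : g 0 * (e - z * s) = c := by
  have hX : (PowerSeries.X : ℂ⟦X⟧) ∣ z := PowerSeries.X_dvd_iff.2 hz
  suffices H : ∀ k, g k * (e - z * s) = c * s ^ k by simpa using H 0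
  intro k
  apply eq_of_forall_X_pow_dvd
  -- Up to the unit `e`, the defect at `k` is `z` times the defect at `k + 1`, hence divisible by
  -- arbitrarily high powers of the variable.
  intro n
  induction n generalizing k with
  | zero => simp
  | succ n ih =>
    rw [← he.dvd_mul_left]
    have : e * (g k * (e - z * s) - c * s ^ k) =
        z * (g (k + 1) * (e - z * s) - c * s ^ (k + 1)) := by
      linear_combination (e - z * s) * hg k
    rw [this, pow_succ']
    exact mul_dvd_mul hX (ih _)

end Resolvents

/-! ### Uniqueness of solutions of the moment equation. -/

section FixedPoint

theorem X_pow_dvd_subst_sub_subst (q : ℕ → ℂ) {a b : ℂ⟦X⟧} {n : ℕ}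
    (ha : PowerSeries.constantCoeff a = 0) (hb : PowerSeries.constantCoeff b = 0)
    (h : (PowerSeries.X : ℂ⟦X⟧) ^ n ∣ a - b) :
    (PowerSeries.X : ℂ⟦X⟧) ^ n ∣
      (PowerSeries.mk q).subst a - (PowerSeries.mk q).subst b := by
  suffices H : ∀ j ≤ n, ∀ q : ℕ → ℂ, (PowerSeries.X : ℂ⟦X⟧) ^ j ∣
      (PowerSeries.mk q).subst a - (PowerSeries.mk q).subst b from H n le_rfl q
  intro j
  induction j with
  | zero => simp
  | succ j ih =>
    intro hj q
    rw [subst_mk_eq q ha, subst_mk_eq q hb]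
    have : PowerSeries.C (q 0) + a * (PowerSeries.mk fun n => q (n + 1)).subst a -
        (PowerSeries.C (q 0) + b * (PowerSeries.mk fun n => q (n + 1)).subst b) =
        (a - b) * (PowerSeries.mk fun n => q (n + 1)).subst a +
        b * ((PowerSeries.mk fun n => q (n + 1)).subst a -
          (PowerSeries.mk fun n => q (n + 1)).subst b) := by ring
    rw [this]
    refine dvd_add (((pow_dvd_pow _ hj).trans h).mul_right _) ?_
    rw [pow_succ']
    exact mul_dvd_mul (PowerSeries.X_dvd_iff.2 hb) (ih (by omega) _)

/-- The right side is a contraction for the adic topology: the factor `u` gains one power of the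
variable. It serves to identify a `ψ`-moment series at `u` with `1 + h`. -/
theorem fixed_point_unique {f u e e' : ℂ⟦X⟧} (hu : PowerSeries.constantCoeff u = 0)
    (he : e = 1 + u * e * f.subst (u * e)) (he' : e' = 1 + u * e' * f.subst (u * e')) :
    e = e' := by
  apply eq_of_forall_X_pow_dvd
  intro n
  have hX : (PowerSeries.X : ℂ⟦X⟧) ∣ u := PowerSeries.X_dvd_iff.2 hu
  induction n with
  | zero => simp
  | succ n ih =>
    have h1 : (PowerSeries.X : ℂ⟦X⟧) ^ n ∣ f.subst (u * e) - f.subst (u * e') := by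
      have hf : f = PowerSeries.mk fun k => PowerSeries.coeff k f := by ext; simp
      rw [hf]
      refine X_pow_dvd_subst_sub_subst _ (by simp [hu]) (by simp [hu]) ?_
      rw [← mul_sub]
      exact ih.mul_left u
    have h2 : e - e' =
        u * ((e - e') * f.subst (u * e) + e' * (f.subst (u * e) - f.subst (u * e'))) := by
      linear_combination he - he'
    rw [h2, pow_succ']
    exact mul_dvd_mul hX (dvd_add (ih.mul_right _) (h1.mul_left _))

end FixedPoint

/-! ### Multiplicativity of the c-free cumulants from the subordination system. -/

section Freeness

variable {A : Type*} [Ring A] [Algebra ℂ A]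

attribute [local instance] seriesAlgebra

theorem subst_momentSeries (φ ψ : A →ₗ[ℂ] ℂ) (hφ : φ 1 = 1) (hψ : ψ 1 = 1) (T : A)
    {t : ℂ⟦X⟧} (ht : PowerSeries.constantCoeff t = 0) :
    (momentSeries φ T).subst t = 1 + t * (momentSeries φ T).subst t *
      (divZ (cRTransform φ ψ T)).subst (t * (momentSeries ψ T).subst t) := by
  have hs : PowerSeries.HasSubst t := PowerSeries.HasSubst.of_constantCoeff_zero' ht
  have hs' : PowerSeries.HasSubst (PowerSeries.X * momentSeries ψ T) :=
    PowerSeries.HasSubst.of_constantCoeff_zero' (by simp)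
  have h1 : (1 : ℂ⟦X⟧).subst t = 1 := by
    rw [← PowerSeries.coe_substAlgHom hs, map_one]
  conv_lhs => rw [momentSeries_eq φ ψ hφ hψ T]
  rw [PowerSeries.subst_add hs, PowerSeries.subst_mul hs, PowerSeries.subst_mul hs,
    PowerSeries.subst_X hs, PowerSeries.subst_comp_subst_apply hs' hs,
    PowerSeries.subst_mul hs, PowerSeries.subst_X hs, h1]

/-- The series of the centred powers of `T`, divided by its variable. -/
noncomputable def centredSeries (ψ : A →ₗ[ℂ] ℂ) (T : A) (t : ℂ⟦X⟧) : A⟦X⟧ :=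
  ser (fun k => T ^ (k + 1) - algebraMap ℂ A (ψ (T ^ (k + 1)))) t

theorem coeff_centredSeries {ψ : A →ₗ[ℂ] ℂ} (hψ : ψ 1 = 1) (T : A) (t : ℂ⟦X⟧) (n : ℕ) :
    PowerSeries.coeff n (centredSeries ψ T t) ∈ Algebra.adjoin ℂ {T} ∧
      ψ (PowerSeries.coeff n (centredSeries ψ T t)) = 0 := by
  rw [centredSeries, ser, PowerSeries.coeff_mk]
  constructor
  · refine sum_mem fun k _ => Subalgebra.smul_mem _ (sub_mem ?_ ?_) _
    · exact pow_mem (Algebra.self_mem_adjoin_singleton ℂ T) _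
    · exact Subalgebra.algebraMap_mem _ _
  · rw [map_sum]
    refine Finset.sum_eq_zero fun k _ => ?_
    rw [map_smul, map_sub, Algebra.algebraMap_eq_smul_one, map_smul, hψ]
    simp

/-- The resolvent splits into its `ψ`-mean and a centred part; the centred part is divisible by `t`
because the zeroth power has no centred part. -/
theorem geom_eq_add_smul_centredSeries {ψ : A →ₗ[ℂ] ℂ} (hψ : ψ 1 = 1) (T : A) {t : ℂ⟦X⟧}
    (ht : PowerSeries.constantCoeff t = 0) :
    ser (fun k => T ^ k) t =
      (momentSeries ψ T).subst t • (1 : A⟦X⟧) + t • centredSeries ψ T t := by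
  rw [centredSeries, smul_ser_succ (fun k => T ^ k - algebraMap ℂ A (ψ (T ^ k))) ht, ser_sub,
    ser_algebraMap, ser_eq_subst _ ht, momentSeries]
  simp [hψ]

/-- Iterating `resolvent_identity` inside `χ(b · a)` yields the words `b (a'b')^k a`, whose values
are geometric in `k` by `extend_framed`. The functional `χ` is kept separate from `ψ` so that the
result applies both to `ψ` itself, where the centred parts vanish, and to `φ`. -/
theorem extend_geom_mul {χ ψ : A →ₗ[ℂ] ℂ} {X Y : A}
    (h : CondFree χ ψ X Y) (hχ : χ 1 = 1) (hψ : ψ 1 = 1) {u v z m : ℂ⟦X⟧}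
    (hu : PowerSeries.constantCoeff u = 0) (hv : PowerSeries.constantCoeff v = 0)
    (hz : PowerSeries.constantCoeff z = 0) (hm : PowerSeries.constantCoeff m = 0)
    (hm0 : m ≠ 0) (huv : u * v * (1 + m) = z * m)
    (hX : (momentSeries ψ X).subst u = 1 + m) (hY : (momentSeries ψ Y).subst v = 1 + m) :
    (momentSeries χ (X * Y)).subst z * ((1 + m) ^ 2 -
        z * (extend χ (centredSeries ψ X u) * extend χ (centredSeries ψ Y v))) =
      (1 + m) * ((momentSeries χ X).subst u * (momentSeries χ Y).subst v) := by
  have ha := geom_eq_add_smul_centredSeries hψ X hu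
  have hb := geom_eq_add_smul_centredSeries hψ Y hv
  have ca := coeff_centredSeries hψ X u
  have cb := coeff_centredSeries hψ Y v
  have hres := resolvent_identity (x := PowerSeries.C X) (y := PowerSeries.C Y)
    (N := ser (fun k => (X * Y) ^ k) z)
    (geom_mul_one_sub_smul X hu) (geom_mul_one_sub_smul Y hv) (one_sub_smul_mul_geom Y hv)
    (by rw [← map_mul]; exact one_sub_smul_mul_geom (X * Y) hz) (hX ▸ ha) (hY ▸ hb) huv
  -- Framing `G` by `b` and `a` undoes its two outer factors, so the term `k = 0` of the recursion
  -- below is the moment series of `XY`.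
  have hN : ser (fun k => Y ^ k) v * ((1 - v • PowerSeries.C Y) *
      ser (fun k => (X * Y) ^ k) z * (1 - u • PowerSeries.C X)) * ser (fun k => X ^ k) u =
      ser (fun k => (X * Y) ^ k) z := by
    calc _ = (ser (fun k => Y ^ k) v * (1 - v • PowerSeries.C Y)) *
          ser (fun k => (X * Y) ^ k) z *
          ((1 - u • PowerSeries.C X) * ser (fun k => X ^ k) u) := by simp only [mul_assoc]
      _ = _ := by
        rw [geom_mul_one_sub_smul Y hv, one_sub_smul_mul_geom X hu, one_mul, mul_one]
  rw [← extend_geom χ X hu, ← extend_geom χ Y hv, ← extend_geom χ (X * Y) hz]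
  rw [hX] at ha
  rw [hY] at hb
  have hfr := extend_framed h hχ ca cb ha hb
  generalize (1 - v • PowerSeries.C Y) * ser (fun k => (X * Y) ^ k) z *
    (1 - u • PowerSeries.C X) = G at hres hN
  generalize ser (fun k => X ^ k) u = a at *
  generalize ser (fun k => Y ^ k) v = b at *
  generalize centredSeries ψ X u = a' at *
  generalize centredSeries ψ Y v = b' at *
  rw [← hN]
  have he : IsUnit ((1 + m) ^ 2) := by
    rw [PowerSeries.isUnit_iff_constantCoeff]
    simp [hm]
  -- The recursion is known only after multiplication by `m`, whence the cancellation of `m ≠ 0`.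
  have := solve_geometric_recursion (g := fun k => extend χ (b * (a' * b') ^ k * G * a))
    (c := (1 + m) * (extend χ a * extend χ b)) (s := extend χ a' * extend χ b') hz he
    (fun k => mul_left_cancel₀ hm0 ?_)
  · simpa using this
  · have h1 := congrArg (fun t => extend χ (b * (a' * b') ^ k * t * a)) hres
    simp only [mul_add, add_mul, mul_smul_comm, smul_mul_assoc, mul_one, map_add, map_smul,
      smul_eq_mul, hfr] at h1
    have h2 : b * (a' * b') ^ k * (a' * (b' * G)) * a = b * (a' * b') ^ (k + 1) * G * a := by
      simp only [pow_succ, mul_assoc]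
    simp only [mul_assoc] at h1 h2 ⊢
    rw [h2] at h1
    linear_combination h1

theorem eq_mul_of_moment_relations {K : Type*} [CommRing K] [IsDomain K]
    {h z u v p q PX PY PN c cX cY : K} (hz : z ≠ 0) (hh : h ≠ 0) (he : 1 + h ≠ 0)
    (hPX : PX ≠ 0) (hPY : PY ≠ 0) (hPN : PN ≠ 0)
    (h1 : PN * ((1 + h) ^ 2 - z * (p * q)) = (1 + h) * (PX * PY))
    (h2 : PX = 1 + h + u * p) (h3 : PY = 1 + h + v * q)
    (hX : PX = 1 + u * PX * cX) (hY : PY = 1 + v * PY * cY) (hN : PN = 1 + z * PN * c)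
    (huv : u * v * (1 + h) = z * h) : c = cX * cY := by
  have e1 : PN * ((1 + h) * PX + (1 + h) * PY - (1 + h) - PX * PY) = h * (PX * PY) := by
    apply mul_left_cancel₀ he
    have hup : u * p = PX - (1 + h) := by rw [h2]; ring
    have hvq : v * q = PY - (1 + h) := by rw [h3]; ring
    have : (1 + h) * ((PX - (1 + h)) * (PY - (1 + h))) = h * z * (p * q) := by
      rw [← hup, ← hvq]
      linear_combination (p * q) * huv
    linear_combination h * h1 - PN * this
  -- Divided by `PN * PX * PY`, this is `h(1-1/PN) = (1+h)(1-1/PX)(1-1/PY)`, and each `1-1/P` is a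
  -- variable times a cumulant series.
  have e2 : (PN - 1) * (h * (PX * PY)) = PN * (1 + h) * ((PX - 1) * (PY - 1)) := by
    linear_combination e1
  have hX' : PX - 1 = u * PX * cX := by linear_combination hX
  have hY' : PY - 1 = v * PY * cY := by linear_combination hY
  have hN' : PN - 1 = z * PN * c := by linear_combination hN
  rw [hX', hY', hN'] at e2
  have h0 : z * h * PN * PX * PY ≠ 0 := by simp [hz, hh, hPX, hPY, hPN]
  apply mul_left_cancel₀ h0
  linear_combination e2 + PN * PX * PY * cX * cY * huv

theorem momentSeries_subst_ne_zero {φ ψ : A →ₗ[ℂ] ℂ} (hφ : φ 1 = 1) (hψ : ψ 1 = 1) (T : A)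
    {t : ℂ⟦X⟧} (ht : PowerSeries.constantCoeff t = 0) : (momentSeries φ T).subst t ≠ 0 := by
  intro h0
  have := congrArg PowerSeries.constantCoeff (subst_momentSeries φ ψ hφ hψ T ht)
  simp [h0] at this

/-- On centred letters both sides of the factorization for `ψ` vanish, so freeness is c-freeness of
the pair `(ψ, ψ)`. -/
theorem CondFree.free {φ ψ : A →ₗ[ℂ] ℂ} {X Y : A} (h : CondFree φ ψ X Y) :
    CondFree ψ ψ X Y := by
  intro n ε a h1 h2 h3
  have := (h n ε a h1 h2 h3).1
  refine ⟨this, ?_⟩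
  rw [this, Finset.prod_eq_zero (Finset.mem_univ 0) (h3 0)]

/-- The multiplicativity of the c-free cumulants, in terms of the pair `(F, G)` which solves the
subordination equations. -/
theorem divZ_cRTransform_mul {φ ψ : A →ₗ[ℂ] ℂ} (hφ : φ 1 = 1) (hψ : ψ 1 = 1) {X Y : A}
    (hXY : CondFree φ ψ X Y) {F G : ℂ⟦X⟧} (hF0 : F ≠ 0) (hG0 : G ≠ 0)
    (hF : F = PowerSeries.X * (divZ (RTransform ψ Y)).subst G)
    (hG : G = PowerSeries.X * (divZ (RTransform ψ X)).subst F) :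
    divZ (cRTransform φ ψ (X * Y)) =
      (divZ (cRTransform φ ψ X)).subst F * (divZ (cRTransform φ ψ Y)).subst G := by
  have hFc : PowerSeries.constantCoeff F = 0 := by rw [hF]; simp
  have hGc : PowerSeries.constantCoeff G = 0 := by rw [hG]; simp
  obtain ⟨h, hh⟩ : ∃ h, h = F * (divZ (RTransform ψ X)).subst F := ⟨_, rfl⟩
  have hFG : PowerSeries.X * h = F * G := by
    rw [hh, mul_left_comm, ← hG]
  have hh' : h = G * (divZ (RTransform ψ Y)).subst G := by
    apply mul_left_cancel₀ (PowerSeries.X_ne_zero (R := ℂ))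
    rw [hFG, mul_left_comm, ← hF, mul_comm]
  have hhc : PowerSeries.constantCoeff h = 0 := by rw [hh, map_mul, hFc, zero_mul]
  have hh0 : h ≠ 0 := by
    rintro rfl
    rw [mul_zero] at hFG
    exact mul_ne_zero hF0 hG0 hFG.symm
  -- The arguments `F * i`, `G * i`, `X * i` are chosen so that multiplying them by the common
  -- moment value `1 + h` gives back `F`, `G` and the variable, the arguments required in the c-free
  -- cumulant series.
  obtain ⟨i, hi⟩ : ∃ i, (1 + h) * i = 1 := by
    have : IsUnit (1 + h) := by
      rw [PowerSeries.isUnit_iff_constantCoeff]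
      simp [hhc]
    exact this.exists_right_inv
  have hi0 : i ≠ 0 := right_ne_zero_of_mul_eq_one hi
  have he0 : 1 + h ≠ 0 := left_ne_zero_of_mul_eq_one hi
  have hFi : F * i * (1 + h) = F := by linear_combination F * hi
  have hGi : G * i * (1 + h) = G := by linear_combination G * hi
  have hXi : PowerSeries.X * i * (1 + h) = PowerSeries.X := by
    linear_combination PowerSeries.X * hi
  have hu : PowerSeries.constantCoeff (F * i) = 0 := by rw [map_mul, hFc, zero_mul]
  have hv : PowerSeries.constantCoeff (G * i) = 0 := by rw [map_mul, hGc, zero_mul]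
  have hz : PowerSeries.constantCoeff (PowerSeries.X * i) = 0 := by simp
  have huv : F * i * (G * i) * (1 + h) = PowerSeries.X * i * h := by
    linear_combination i * hFG.symm + F * G * i * hi
  have hmX : (momentSeries ψ X).subst (F * i) = 1 + h := by
    refine fixed_point_unique hu (f := divZ (RTransform ψ X)) ?_ ?_
    · conv_lhs => rw [subst_momentSeries ψ ψ hψ hψ X hu, cRTransform_self]
    · rw [hFi, ← hh]
  have hmY : (momentSeries ψ Y).subst (G * i) = 1 + h := by
    refine fixed_point_unique hv (f := divZ (RTransform ψ Y)) ?_ ?_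
    · conv_lhs => rw [subst_momentSeries ψ ψ hψ hψ Y hv, cRTransform_self]
    · rw [hGi, ← hh']
  have hmXY : (momentSeries ψ (X * Y)).subst (PowerSeries.X * i) = 1 + h := by
    have := extend_geom_mul hXY.free hψ hψ hu hv hz hhc hh0 huv hmX hmY
    -- For `ψ` the geometric series reduces to its first term.
    have h0 : extend ψ (centredSeries ψ X (F * i)) = 0 := by
      ext n
      rw [coeff_extend, (coeff_centredSeries hψ X _ n).2, map_zero]
    rw [h0, hmX, hmY] at this
    apply mul_right_cancel₀ (pow_ne_zero 2 he0)
    linear_combination this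
  have hPX := subst_momentSeries φ ψ hφ hψ X hu
  have hPY := subst_momentSeries φ ψ hφ hψ Y hv
  have hPN := subst_momentSeries φ ψ hφ hψ (X * Y) hz
  rw [hmX, hFi] at hPX
  rw [hmY, hGi] at hPY
  rw [hmXY, hXi, PowerSeries.X_subst] at hPN
  have ha := congrArg (extend φ) (geom_eq_add_smul_centredSeries hψ X hu)
  have hb := congrArg (extend φ) (geom_eq_add_smul_centredSeries hψ Y hv)
  rw [extend_geom φ X hu, hmX, map_add, map_smul, map_smul, extend_one hφ, smul_eq_mul,
    smul_eq_mul, mul_one] at ha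
  rw [extend_geom φ Y hv, hmY, map_add, map_smul, map_smul, extend_one hφ, smul_eq_mul,
    smul_eq_mul, mul_one] at hb
  exact eq_mul_of_moment_relations (mul_ne_zero PowerSeries.X_ne_zero hi0) hh0 he0
    (momentSeries_subst_ne_zero hφ hψ X hu) (momentSeries_subst_ne_zero hφ hψ Y hv)
    (momentSeries_subst_ne_zero hφ hψ (X * Y) hz)
    (extend_geom_mul hXY hφ hψ hu hv hz hhc hh0 huv hmX hmY) ha hb hPX hPY hPN huv

end Freeness

/-! ### Pairs of complementary non-crossing partitions as relations on an interval. -/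

section Complementary

/-- An equivalence relation `E` on the interval `[s, t)` which relates only numbers of the same
parity, such that two numbers of the same parity are equivalent if and only if no equivalence
class of the other parity separates them: the partition of the even numbers and the one of the odd
numbers are the Kreweras complements of each other. -/
def Complementary (s t : ℕ) (E : Finset (ℕ × ℕ)) : Prop :=
  ∀ i j, (i, j) ∈ E ↔ (s ≤ i ∧ i < t) ∧ (s ≤ j ∧ j < t) ∧ i % 2 = j % 2 ∧
    ∀ x y, (x, y) ∈ E → x % 2 ≠ i % 2 → ((i < x ↔ j < x) ↔ (i < y ↔ j < y))

namespace Complementary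

variable {s t b : ℕ} {E E₁ E₂ : Finset (ℕ × ℕ)}

theorem bounds (h : Complementary s t E) {i j : ℕ} (hij : (i, j) ∈ E) :
    (s ≤ i ∧ i < t) ∧ (s ≤ j ∧ j < t) ∧ i % 2 = j % 2 :=
  ⟨((h i j).1 hij).1, ((h i j).1 hij).2.1, ((h i j).1 hij).2.2.1⟩

theorem not_separated (h : Complementary s t E) {i j x y : ℕ} (hij : (i, j) ∈ E)
    (hxy : (x, y) ∈ E) (hp : x % 2 ≠ i % 2) : (i < x ↔ j < x) ↔ (i < y ↔ j < y) :=
  ((h i j).1 hij).2.2.2 x y hxy hp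

theorem refl (h : Complementary s t E) {i : ℕ} (h1 : s ≤ i) (h2 : i < t) : (i, i) ∈ E := by
  rw [h]
  simp [h1, h2]

theorem symm (h : Complementary s t E) {i j : ℕ} (hij : (i, j) ∈ E) : (j, i) ∈ E := by
  obtain ⟨h1, h2, h3⟩ := h.bounds hij
  refine (h j i).2 ⟨h2, h1, h3.symm, fun x y hxy hp => ?_⟩
  have := h.not_separated hij hxy (by omega)
  omega

theorem trans (h : Complementary s t E) {i j k : ℕ} (hij : (i, j) ∈ E) (hjk : (j, k) ∈ E) :
    (i, k) ∈ E := by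
  obtain ⟨h1, h2, h3⟩ := h.bounds hij
  obtain ⟨h4, h5, h6⟩ := h.bounds hjk
  refine (h i k).2 ⟨h1, h5, by omega, fun x y hxy hp => ?_⟩
  have := h.not_separated hij hxy (by omega)
  have := h.not_separated hjk hxy (by omega)
  omega

/-- Non-crossing is not part of the definition but follows from it. For equal parities, a class
separating `i` from `j` would separate `i` from `k` or `j` from `l`; for different parities, the two
crossing classes would separate each other. -/
theorem noncrossing (h : Complementary s t E) {i j k l : ℕ} (hik : (i, k) ∈ E)
    (hjl : (j, l) ∈ E) (hij : i < j) (hjk : j < k) (hkl : k < l) : (i, j) ∈ E := by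
  obtain ⟨h1, h2, h3⟩ := h.bounds hik
  obtain ⟨h4, h5, h6⟩ := h.bounds hjl
  by_cases hp : j % 2 = i % 2
  · refine (h i j).2 ⟨h1, h4, hp.symm, fun x y hxy hp' => ?_⟩
    have := h.not_separated hik hxy hp'
    have := h.not_separated hjl hxy (by omega)
    omega
  · have := h.not_separated hik hjl hp
    omega

/-- All numbers of the other parity lie strictly between the two ends, so no class can separate
these. -/
theorem ends (h : Complementary s t E) {e : ℕ} (hs : s ≤ e) (ht : t = e + 1)
    (hp : e % 2 = s % 2) : (s, e) ∈ E := by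
  refine (h s e).2 ⟨by omega, by omega, hp.symm, fun x y hxy hx => ?_⟩
  have := h.bounds hxy
  omega

end Complementary

/-- The relation on `[s, t)` built from a relation on `[s + 1, b)` and a relation on `[b, t)` by
adding `s` to the class of `b`. -/
def glue (s b : ℕ) (E₁ E₂ : Finset (ℕ × ℕ)) : Finset (ℕ × ℕ) :=
  E₁ ∪ E₂ ∪ {(s, s)} ∪ (E₂.filter fun p => p.1 = b).image (fun p => (s, p.2)) ∪
    (E₂.filter fun p => p.2 = b).image (fun p => (p.1, s))

theorem mem_glue {s b : ℕ} {E₁ E₂ : Finset (ℕ × ℕ)} {x y : ℕ} :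
    (x, y) ∈ glue s b E₁ E₂ ↔ (x, y) ∈ E₁ ∨ (x, y) ∈ E₂ ∨ (x = s ∧ y = s) ∨
      (x = s ∧ (b, y) ∈ E₂) ∨ (y = s ∧ (x, b) ∈ E₂) := by
  simp only [glue, Finset.mem_union, Finset.mem_image, Finset.mem_filter, Finset.mem_singleton,
    Prod.mk.injEq, Prod.exists]
  grind

namespace Complementary

variable {s t b : ℕ} {E E₁ E₂ : Finset (ℕ × ℕ)}

theorem glue_not_separated (h₁ : Complementary (s + 1) b E₁) (h₂ : Complementary b t E₂)
    (hp : b % 2 = s % 2) (hsb : s < b) {i j x y : ℕ}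
    (hij : (i, j) ∈ glue s b E₁ E₂) (hxy : (x, y) ∈ glue s b E₁ E₂) (hx : x % 2 ≠ i % 2) :
    (i < x ↔ j < x) ↔ (i < y ↔ j < y) := by
  rcases mem_glue.1 hij with hi | hi | ⟨rfl, rfl⟩ | ⟨rfl, hi⟩ | ⟨rfl, hi⟩
  · have b1 := h₁.bounds hi
    rcases mem_glue.1 hxy with hx' | hx' | ⟨rfl, rfl⟩ | ⟨rfl, hx'⟩ | ⟨rfl, hx'⟩
    · exact h₁.not_separated hi hx' hx
    · have := h₂.bounds hx'; omega
    · omega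
    · have := h₂.bounds hx'; omega
    · have := h₂.bounds hx'; omega
  · have b1 := h₂.bounds hi
    rcases mem_glue.1 hxy with hx' | hx' | ⟨rfl, rfl⟩ | ⟨rfl, hx'⟩ | ⟨rfl, hx'⟩
    · have := h₁.bounds hx'; omega
    · exact h₂.not_separated hi hx' hx
    · omega
    · have := h₂.bounds hx'
      have := h₂.not_separated hi hx' (by omega)
      omega
    · have := h₂.bounds hx'
      have := h₂.not_separated hi hx' (by omega)
      omega
  · tauto
  · have b1 := h₂.bounds hi
    rcases mem_glue.1 hxy with hx' | hx' | ⟨rfl, rfl⟩ | ⟨rfl, hx'⟩ | ⟨rfl, hx'⟩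
    · have := h₁.bounds hx'; omega
    · have := h₂.bounds hx'
      have := h₂.not_separated hi hx' (by omega)
      omega
    · omega
    · omega
    · have := h₂.bounds hx'; omega
  · have b1 := h₂.bounds hi
    rcases mem_glue.1 hxy with hx' | hx' | ⟨rfl, rfl⟩ | ⟨rfl, hx'⟩ | ⟨rfl, hx'⟩
    · have := h₁.bounds hx'; omega
    · have := h₂.bounds hx'
      have := h₂.not_separated hi hx' (by omega)
      omega
    · omega
    · omega
    · have := h₂.bounds hx'; omega

theorem glue_symm (h₁ : Complementary (s + 1) b E₁) (h₂ : Complementary b t E₂) {i j : ℕ}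
    (hij : (i, j) ∈ glue s b E₁ E₂) : (j, i) ∈ glue s b E₁ E₂ := by
  rw [mem_glue] at hij ⊢
  rcases hij with hi | hi | ⟨rfl, rfl⟩ | ⟨rfl, hi⟩ | ⟨rfl, hi⟩
  · exact Or.inl (h₁.symm hi)
  · exact Or.inr (Or.inl (h₂.symm hi))
  · tauto
  · have := h₂.symm hi
    tauto
  · have := h₂.symm hi
    tauto

/-- The delicate point is that no pair across the two intervals becomes equivalent: an inner number
with the parity of `s` is cut off from `s` and from `[b, t)` by the class joining `s + 1` and `b -
1`, and an inner number of the other parity is cut off from `[b, t)` by the class joining `s` and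
`b`. -/
theorem glue (h₁ : Complementary (s + 1) b E₁) (h₂ : Complementary b t E₂) (hp : b % 2 = s % 2)
    (hsb : s < b) (hbt : b < t) : Complementary s t (glue s b E₁ E₂) := by
  have hb : (s, b) ∈ CFree.glue s b E₁ E₂ := by
    rw [mem_glue]
    have := h₂.refl le_rfl hbt
    tauto
  have hends : (s + 1, b - 1) ∈ CFree.glue s b E₁ E₂ :=
    mem_glue.2 (Or.inl (h₁.ends (by omega) (by omega) (by omega)))
  have hlt : ∀ i j, s ≤ i → i ≤ j → j < t → i % 2 = j % 2 →
      (∀ x y, (x, y) ∈ CFree.glue s b E₁ E₂ → x % 2 ≠ i % 2 →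
        ((i < x ↔ j < x) ↔ (i < y ↔ j < y))) → (i, j) ∈ CFree.glue s b E₁ E₂ := by
    intro i j hi hij hj hpar hsep
    rw [mem_glue]
    by_cases hib : b ≤ i
    · refine Or.inr (Or.inl ((h₂ i j).2 ⟨by omega, by omega, hpar, fun x y hxy => ?_⟩))
      exact hsep x y (mem_glue.2 (Or.inr (Or.inl hxy)))
    by_cases his : i = s
    · subst his
      by_cases hjb : b ≤ j
      · refine Or.inr (Or.inr (Or.inr (Or.inl ⟨rfl, (h₂ b j).2
          ⟨by omega, by omega, by omega, fun x y hxy hx => ?_⟩⟩)))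
        have := hsep x y (mem_glue.2 (Or.inr (Or.inl hxy))) (by omega)
        have := h₂.bounds hxy
        omega
      · by_cases hji : j = i
        · tauto
        · have := hsep _ _ hends (by omega)
          omega
    · by_cases hjb : b ≤ j
      · by_cases hpi : i % 2 = s % 2
        · have := hsep _ _ hends (by omega)
          omega
        · have := hsep _ _ hb (by omega)
          omega
      · refine Or.inl ((h₁ i j).2 ⟨by omega, by omega, hpar, fun x y hxy => ?_⟩)
        exact hsep x y (mem_glue.2 (Or.inl hxy))
  intro i j
  constructor
  · intro hij
    have hbd : (s ≤ i ∧ i < t) ∧ (s ≤ j ∧ j < t) ∧ i % 2 = j % 2 := by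
      rcases mem_glue.1 hij with hi | hi | ⟨rfl, rfl⟩ | ⟨rfl, hi⟩ | ⟨rfl, hi⟩
      · have := h₁.bounds hi; omega
      · have := h₂.bounds hi; omega
      · omega
      · have := h₂.bounds hi; omega
      · have := h₂.bounds hi; omega
    exact ⟨hbd.1, hbd.2.1, hbd.2.2, fun x y hxy hx => glue_not_separated h₁ h₂ hp hsb hij hxy hx⟩
  · rintro ⟨hi, hj, hpar, hsep⟩
    rcases le_total i j with hle | hle
    · exact hlt i j hi.1 hle hj.2 hpar hsep
    · refine glue_symm h₁ h₂ (hlt j i hj.1 hle hi.2 hpar.symm fun x y hxy hx => ?_)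
      have := hsep x y hxy (by omega)
      omega

/-- If `b` is the successor of `s` in its class, no class meets both `(s, b)` and its
complement. -/
theorem bounds_of_gap (h : Complementary s t E) (hsb : (s, b) ∈ E)
    (hmin : ∀ y, s < y → y < b → (s, y) ∉ E) {x y : ℕ} (hxy : (x, y) ∈ E) (hx : s < x)
    (hxb : x < b) : s < y ∧ y < b := by
  by_contra hy
  have b1 := h.bounds hsb
  have b2 := h.bounds hxy
  by_cases hp : x % 2 = s % 2
  · rcases lt_trichotomy y b with hlt | rfl | hgt
    · obtain rfl : y = s := by omega
      exact hmin x hx hxb (h.symm hxy)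
    · exact hmin x hx hxb (h.trans hsb (h.symm hxy))
    · exact hmin x hx hxb (h.noncrossing hsb hxy hx hxb hgt)
  · have := h.not_separated hsb hxy hp
    have : y ≠ s := by omega
    have : y ≠ b := by omega
    omega

theorem restrict_gap (h : Complementary s t E) (hsb : (s, b) ∈ E)
    (hmin : ∀ y, s < y → y < b → (s, y) ∉ E) :
    Complementary (s + 1) b (E.filter fun p => (s < p.1 ∧ p.1 < b) ∧ s < p.2 ∧ p.2 < b) := by
  have b1 := h.bounds hsb
  intro i j
  simp only [Finset.mem_filter]
  constructor
  · rintro ⟨hij, hi, hj⟩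
    refine ⟨by omega, by omega, (h.bounds hij).2.2, fun x y hxy => h.not_separated hij hxy.1⟩
  · rintro ⟨hi, hj, hp, hsep⟩
    refine ⟨(h i j).2 ⟨by omega, by omega, hp, fun x y hxy hx => ?_⟩, by omega, by omega⟩
    by_cases hxg : s < x ∧ x < b
    · have := h.bounds_of_gap hsb hmin hxy hxg.1 hxg.2
      exact hsep x y ⟨hxy, hxg, this⟩ hx
    · have : ¬(s < y ∧ y < b) := fun hy =>
        hxg (h.bounds_of_gap hsb hmin (h.symm hxy) hy.1 hy.2)
      omega

theorem restrict_rest (h : Complementary s t E) (hb : s < b) (hsb : (s, b) ∈ E)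
    (hmin : ∀ y, s < y → y < b → (s, y) ∉ E) :
    Complementary b t (E.filter fun p => b ≤ p.1 ∧ b ≤ p.2) := by
  have b1 := h.bounds hsb
  intro i j
  simp only [Finset.mem_filter]
  constructor
  · rintro ⟨hij, hi, hj⟩
    have := h.bounds hij
    refine ⟨by omega, by omega, this.2.2, fun x y hxy => h.not_separated hij hxy.1⟩
  · rintro ⟨hi, hj, hp, hsep⟩
    refine ⟨(h i j).2 ⟨by omega, by omega, hp, fun x y hxy hx => ?_⟩, by omega, by omega⟩
    have b2 := h.bounds hxy
    by_cases hxb : b ≤ x <;> by_cases hyb : b ≤ y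
    · exact hsep x y ⟨hxy, hxb, hyb⟩ hx
    -- Outside `[b, t)` the class of `x` can contain only `s`, since nothing leaves the gap; `b` is
    -- equivalent to `s` and replaces it as a witness inside the interval.
    · have hys : y = s := by
        by_contra hne
        have := h.bounds_of_gap hsb hmin (h.symm hxy) (by omega) (by omega)
        omega
      have := hsep x b ⟨h.trans hxy (hys ▸ hsb), hxb, le_rfl⟩ hx
      omega
    · have hxs : x = s := by
        by_contra hne
        have := h.bounds_of_gap hsb hmin hxy (by omega) (by omega)
        omega
      have := hsep b y ⟨h.trans (h.symm hsb) (hxs ▸ hxy), le_rfl, hyb⟩ (by omega)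
      omega
    · omega

theorem glue_restrict (h : Complementary s t E) (hb : s < b) (hsb : (s, b) ∈ E)
    (hmin : ∀ y, s < y → y < b → (s, y) ∉ E) :
    CFree.glue s b (E.filter fun p => (s < p.1 ∧ p.1 < b) ∧ s < p.2 ∧ p.2 < b)
      (E.filter fun p => b ≤ p.1 ∧ b ≤ p.2) = E := by
  have b1 := h.bounds hsb
  ext ⟨x, y⟩
  rw [mem_glue]
  simp only [Finset.mem_filter]
  constructor
  · rintro (hx | hx | ⟨rfl, rfl⟩ | ⟨rfl, hx⟩ | ⟨rfl, hx⟩)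
    · exact hx.1
    · exact hx.1
    · exact h.refl le_rfl (by omega)
    · exact h.trans hsb hx.1
    · exact h.trans hx.1 (h.symm hsb)
  · intro hxy
    have b2 := h.bounds hxy
    by_cases hxg : s < x ∧ x < b
    · have := h.bounds_of_gap hsb hmin hxy hxg.1 hxg.2
      exact Or.inl ⟨hxy, hxg, this⟩
    · have hyg : ¬(s < y ∧ y < b) := fun hy =>
        hxg (h.bounds_of_gap hsb hmin (h.symm hxy) hy.1 hy.2)
      by_cases hxs : x = s <;> by_cases hys : y = s
      · tauto
      · subst hxs
        exact Or.inr (Or.inr (Or.inr (Or.inl ⟨rfl, h.trans (h.symm hsb) hxy, le_rfl, by omega⟩)))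
      · subst hys
        exact Or.inr (Or.inr (Or.inr (Or.inr ⟨rfl, h.trans hxy hsb, by omega, le_rfl⟩)))
      · exact Or.inr (Or.inl ⟨hxy, by omega, by omega⟩)

end Complementary

end Complementary

/-! ### Weighted sums over complementary relations and their generating series. -/

section Weights

/-- The finite set of the relations on `[s, t)` which are complementary. -/
noncomputable def complementarySet (s t : ℕ) : Finset (Finset (ℕ × ℕ)) :=
  open Classical in
  (Finset.Ico s t ×ˢ Finset.Ico s t).powerset.filter (Complementary s t)

theorem mem_complementarySet {s t : ℕ} {E : Finset (ℕ × ℕ)} :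
    E ∈ complementarySet s t ↔ Complementary s t E := by
  simp only [complementarySet, Finset.mem_filter, Finset.mem_powerset, and_iff_right_iff_imp]
  rintro h ⟨x, y⟩ hxy
  have := h.bounds hxy
  simp only [Finset.mem_product, Finset.mem_Ico]
  omega

/-- The size of the class of `x`. -/
def classSize (E : Finset (ℕ × ℕ)) (x : ℕ) : ℕ := (E.filter fun p => p.1 = x).card

/-- The factor `c x k` if `x` is the least element of its class, of size `k`, and `1`
otherwise. -/
noncomputable def leastWeight (c : ℕ → ℕ → ℂ) (E : Finset (ℕ × ℕ)) (x : ℕ) : ℂ :=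
  open Classical in if ∀ y < x, (x, y) ∉ E then c x (classSize E x) else 1

/-- The sum over the complementary relations on `[s, t)` of the products over the classes of
weights that depend on the least element and on the size of a class, where the class of `s` has
the weight sequence `a`. -/
noncomputable def rootedSum (c : ℕ → ℕ → ℂ) (s t : ℕ) (a : ℕ → ℂ) : ℂ :=
  ∑ E ∈ complementarySet s t,
    a (classSize E s) * ∏ x ∈ Finset.Ico (s + 1) t, leastWeight c E x

theorem classSize_congr {E E' : Finset (ℕ × ℕ)} {x : ℕ}
    (h : ∀ y, (x, y) ∈ E ↔ (x, y) ∈ E') : classSize E x = classSize E' x := by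
  rw [classSize, classSize]
  congr 1
  ext ⟨z, y⟩
  simp only [Finset.mem_filter]
  constructor
  · rintro ⟨h1, rfl⟩
    exact ⟨(h y).1 h1, rfl⟩
  · rintro ⟨h1, rfl⟩
    exact ⟨(h y).2 h1, rfl⟩

theorem leastWeight_congr (c : ℕ → ℕ → ℂ) {E E' : Finset (ℕ × ℕ)} {x : ℕ}
    (h : ∀ y, (x, y) ∈ E ↔ (x, y) ∈ E') : leastWeight c E x = leastWeight c E' x := by
  simp only [leastWeight, classSize_congr h, h]

theorem leastWeight_eq_one (c : ℕ → ℕ → ℂ) {E : Finset (ℕ × ℕ)} {x y : ℕ} (h : (x, y) ∈ E)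
    (hy : y < x) : leastWeight c E x = 1 := by
  rw [leastWeight, if_neg]
  intro h'
  exact h' y hy h

theorem Complementary.leastWeight_left (c : ℕ → ℕ → ℂ) {s t : ℕ} {E : Finset (ℕ × ℕ)}
    (h : Complementary s t E) : leastWeight c E s = c s (classSize E s) := by
  rw [leastWeight, if_pos]
  intro y hy hys
  have := h.bounds hys
  omega

theorem classSize_glue {s t b : ℕ} {E₁ E₂ : Finset (ℕ × ℕ)}
    (h₁ : Complementary (s + 1) b E₁) (h₂ : Complementary b t E₂) (hsb : s < b) :
    classSize (glue s b E₁ E₂) s = classSize E₂ b + 1 := by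
  have : (glue s b E₁ E₂).filter (fun p => p.1 = s) =
      insert (s, s) ((E₂.filter fun p => p.1 = b).image fun p => (s, p.2)) := by
    ext ⟨x, y⟩
    simp only [Finset.mem_filter, mem_glue, Finset.mem_insert, Finset.mem_image, Prod.mk.injEq,
      Prod.exists]
    constructor
    · rintro ⟨h, rfl⟩
      rcases h with h | h | h | h | h
      · have := h₁.bounds h; omega
      · have := h₂.bounds h; omega
      · exact Or.inl h
      · exact Or.inr ⟨b, y, ⟨h.2, rfl⟩, rfl, rfl⟩
      · have := h₂.bounds h.2; omega
    · rintro (⟨rfl, rfl⟩ | ⟨_, _, ⟨h, rfl⟩, rfl, rfl⟩)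
      · tauto
      · tauto
  rw [classSize, this, Finset.card_insert_of_notMem, Finset.card_image_of_injOn, classSize]
  · rintro ⟨x, y⟩ hx ⟨x', y'⟩ hx' hxx
    simp only [Finset.coe_filter, Set.mem_ofPred_eq] at hx hx'
    simp only [Prod.mk.injEq, true_and] at hxx
    rw [hx.2, hx'.2, hxx]
  · simp only [Finset.mem_image, Finset.mem_filter, Prod.mk.injEq, Prod.exists, not_exists]
    rintro x y ⟨⟨h, rfl⟩, -, rfl⟩
    have := h₂.bounds h
    omega

/-- Gluing changes only the class of `b`: it gains the element `s`, which becomes its least element.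
So the root weight is shifted by one, `b` contributes `1`, and the class of `s + 1` supplies the
root of the left factor. -/
theorem weight_glue (c : ℕ → ℕ → ℂ) (a : ℕ → ℂ) {s t b : ℕ} {E₁ E₂ : Finset (ℕ × ℕ)}
    (h₁ : Complementary (s + 1) b E₁) (h₂ : Complementary b t E₂) (hsb : s + 1 < b)
    (hbt : b < t) :
    a (classSize (glue s b E₁ E₂) s) *
        ∏ x ∈ Finset.Ico (s + 1) t, leastWeight c (glue s b E₁ E₂) x =
      (c (s + 1) (classSize E₁ (s + 1)) * ∏ x ∈ Finset.Ico (s + 1 + 1) b, leastWeight c E₁ x) *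
        (a (classSize E₂ b + 1) * ∏ x ∈ Finset.Ico (b + 1) t, leastWeight c E₂ x) := by
  have e1 : ∀ x ∈ Finset.Ico (s + 1) b, leastWeight c (glue s b E₁ E₂) x = leastWeight c E₁ x := by
    intro x hx
    rw [Finset.mem_Ico] at hx
    refine leastWeight_congr c fun y => ?_
    rw [mem_glue]
    constructor
    · rintro (h | h | h | h | h)
      · exact h
      · have := h₂.bounds h; omega
      · omega
      · omega
      · have := h₂.bounds h.2; omega
    · exact Or.inl
  have e2 : ∀ x ∈ Finset.Ico (b + 1) t, leastWeight c (glue s b E₁ E₂) x = leastWeight c E₂ x := by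
    intro x hx
    rw [Finset.mem_Ico] at hx
    by_cases hxb : (x, b) ∈ E₂
    · rw [leastWeight_eq_one c hxb (by omega),
        leastWeight_eq_one c (y := s) (by rw [mem_glue]; tauto) (by omega)]
    · refine leastWeight_congr c fun y => ?_
      rw [mem_glue]
      constructor
      · rintro (h | h | h | h | h)
        · have := h₁.bounds h; omega
        · exact h
        · omega
        · omega
        · exact absurd h.2 hxb
      · tauto
  have e3 : leastWeight c (glue s b E₁ E₂) b = 1 := by
    refine leastWeight_eq_one c (y := s) ?_ (by omega)
    rw [mem_glue]
    have := h₂.refl le_rfl hbt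
    tauto
  rw [classSize_glue h₁ h₂ (by omega), ← h₁.leastWeight_left c,
    ← Finset.prod_eq_prod_Ico_succ_bot hsb, ← Finset.prod_congr rfl e1,
    ← Finset.prod_congr rfl e2,
    ← Finset.prod_Ico_consecutive _ (show s + 1 ≤ b by omega) hbt.le,
    Finset.prod_eq_prod_Ico_succ_bot hbt, e3]
  ring

theorem glue_injective {s t b b' : ℕ} {E₁ E₂ E₁' E₂' : Finset (ℕ × ℕ)}
    (h₁ : Complementary (s + 1) b E₁) (h₂ : Complementary b t E₂)
    (h₁' : Complementary (s + 1) b' E₁') (h₂' : Complementary b' t E₂')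
    (hsb : s < b) (hbt : b < t) (hsb' : s < b') (hbt' : b' < t)
    (h : glue s b E₁ E₂ = glue s b' E₁' E₂') : b = b' ∧ E₁ = E₁' ∧ E₂ = E₂' := by
  have key : ∀ {b b' : ℕ} {E₁ E₂ E₁' E₂' : Finset (ℕ × ℕ)}, Complementary b t E₂ →
      Complementary (s + 1) b' E₁' → Complementary b' t E₂' → s < b → b < t →
      glue s b E₁ E₂ = glue s b' E₁' E₂' → b' ≤ b := by
    intro b b' E₁ E₂ E₁' E₂' h₂ h₁' h₂' hsb hbt h
    have : (s, b) ∈ glue s b' E₁' E₂' := by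
      rw [← h, mem_glue]
      have := h₂.refl le_rfl hbt
      tauto
    rcases mem_glue.1 this with h | h | h | h | h
    · have := h₁'.bounds h; omega
    · have := h₂'.bounds h; omega
    · omega
    · have := h₂'.bounds h.2; omega
    · omega
  obtain rfl : b = b' :=
    le_antisymm (key h₂' h₁ h₂ hsb' hbt' h.symm) (key h₂ h₁' h₂' hsb hbt h)
  refine ⟨rfl, ?_, ?_⟩
  · have key1 : ∀ {E₁ E₂ : Finset (ℕ × ℕ)}, Complementary (s + 1) b E₁ → Complementary b t E₂ →
        ∀ x y, (x, y) ∈ E₁ ↔ (x, y) ∈ glue s b E₁ E₂ ∧ s < x ∧ x < b := by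
      intro E₁ E₂ h₁ h₂ x y
      rw [mem_glue]
      constructor
      · intro h
        have := h₁.bounds h
        exact ⟨Or.inl h, by omega, by omega⟩
      · rintro ⟨h | h | h | h | h, hx⟩
        · exact h
        · have := h₂.bounds h; omega
        · omega
        · omega
        · have := h₂.bounds h.2; omega
    ext ⟨x, y⟩
    rw [key1 h₁ h₂, key1 h₁' h₂', h]
  · have key2 : ∀ {E₁ E₂ : Finset (ℕ × ℕ)}, Complementary (s + 1) b E₁ → Complementary b t E₂ →
        ∀ x y, (x, y) ∈ E₂ ↔ (x, y) ∈ glue s b E₁ E₂ ∧ b ≤ x ∧ b ≤ y := by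
      intro E₁ E₂ h₁ h₂ x y
      rw [mem_glue]
      constructor
      · intro h
        have := h₂.bounds h
        exact ⟨Or.inr (Or.inl h), by omega, by omega⟩
      · rintro ⟨h | h | h | h | h, hx⟩
        · have := h₁.bounds h; omega
        · exact h
        · omega
        · omega
        · omega
    ext ⟨x, y⟩
    rw [key2 h₁ h₂, key2 h₁' h₂', h]

/-- The cut is at the second element `b` of the class of `s`. It exists because the interval has odd
length, so that its last element is equivalent to `s`; it has the parity of `s`, which makes both
pieces of odd length again. -/
theorem exists_eq_glue {s n : ℕ} {E : Finset (ℕ × ℕ)}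
    (h : Complementary s (s + 2 * (n + 1) + 1) E) :
    ∃ i ∈ Finset.range (n + 1), ∃ E₁ E₂, Complementary (s + 1) (s + 2 * i + 2) E₁ ∧
      Complementary (s + 2 * i + 2) (s + 2 * (n + 1) + 1) E₂ ∧
      glue s (s + 2 * i + 2) E₁ E₂ = E := by
  have hex : ∃ b, s < b ∧ (s, b) ∈ E :=
    ⟨s + 2 * (n + 1), by omega, h.ends (by omega) rfl (by omega)⟩
  classical
  obtain ⟨hb, hsb⟩ := Nat.find_spec hex
  have hmin : ∀ y, s < y → y < Nat.find hex → (s, y) ∉ E := fun y h1 h2 h3 =>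
    Nat.find_min hex h2 ⟨h1, h3⟩
  generalize Nat.find hex = b at hb hsb hmin
  have b1 := h.bounds hsb
  obtain ⟨i, rfl⟩ : ∃ i, b = s + 2 * i + 2 := ⟨(b - s) / 2 - 1, by omega⟩
  exact ⟨i, Finset.mem_range.2 (by omega), _, _, h.restrict_gap hsb hmin,
    h.restrict_rest hb hsb hmin, h.glue_restrict hb hsb hmin⟩

theorem rootedSum_succ (c : ℕ → ℕ → ℂ) (s n : ℕ) (a : ℕ → ℂ) :
    rootedSum c s (s + 2 * (n + 1) + 1) a =
      ∑ i ∈ Finset.range (n + 1), rootedSum c (s + 1) (s + 2 * i + 2) (c (s + 1)) *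
        rootedSum c (s + 2 * i + 2) (s + 2 * (n + 1) + 1) fun k => a (k + 1) := by
  simp only [rootedSum, Finset.sum_mul_sum, ← Finset.sum_product']
  rw [Finset.sum_sigma', eq_comm]
  refine Finset.sum_bij (fun p _ => glue s (s + 2 * p.1 + 2) p.2.1 p.2.2) ?_ ?_ ?_ ?_
  · rintro ⟨i, E₁, E₂⟩ hp
    simp only [Finset.mem_sigma, Finset.mem_product, mem_complementarySet,
      Finset.mem_range] at hp ⊢
    exact hp.2.1.glue hp.2.2 (by omega) (by omega) (by omega)
  · rintro ⟨i, E₁, E₂⟩ hp ⟨i', E₁', E₂'⟩ hp' h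
    simp only [Finset.mem_sigma, Finset.mem_product, mem_complementarySet,
      Finset.mem_range] at hp hp'
    obtain ⟨hb, rfl, rfl⟩ := glue_injective hp.2.1 hp.2.2 hp'.2.1 hp'.2.2 (by omega) (by omega)
      (by omega) (by omega) h
    obtain rfl : i = i' := by omega
    rfl
  · intro E hE
    obtain ⟨i, hi, E₁, E₂, h₁, h₂, rfl⟩ := exists_eq_glue (mem_complementarySet.1 hE)
    exact ⟨⟨i, E₁, E₂⟩, by simp only [Finset.mem_sigma, Finset.mem_product,
      mem_complementarySet]; exact ⟨hi, h₁, h₂⟩, rfl⟩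
  · rintro ⟨i, E₁, E₂⟩ hp
    simp only [Finset.mem_sigma, Finset.mem_product, mem_complementarySet,
      Finset.mem_range] at hp
    exact (weight_glue c a hp.2.1 hp.2.2 (by omega) (by omega)).symm

theorem rootedSum_one (c : ℕ → ℕ → ℂ) (s : ℕ) (a : ℕ → ℂ) : rootedSum c s (s + 1) a = a 1 := by
  have : complementarySet s (s + 1) = {{(s, s)}} := by
    ext E
    rw [mem_complementarySet, Finset.mem_singleton]
    constructor
    · intro h
      ext ⟨x, y⟩
      simp only [Finset.mem_singleton, Prod.mk.injEq]
      constructor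
      · intro hxy
        have := h.bounds hxy
        omega
      · rintro ⟨rfl, rfl⟩
        exact h.refl le_rfl (by omega)
    · rintro rfl i j
      simp only [Finset.mem_singleton, Prod.mk.injEq]
      constructor
      · rintro ⟨rfl, rfl⟩
        refine ⟨by omega, by omega, rfl, ?_⟩
        rintro x y ⟨rfl, rfl⟩
        simp
      · omega
  rw [rootedSum, this]
  simp [classSize, Finset.filter_singleton]

/-- Translation of the interval. -/
theorem rootedSum_translate (c : ℕ → ℕ → ℂ) (d n : ℕ) : ∀ (s : ℕ) (a : ℕ → ℂ),
    rootedSum c (s + d) (s + d + 2 * n + 1) a =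
      rootedSum (fun x => c (x + d)) s (s + 2 * n + 1) a := by
  induction n using Nat.strong_induction_on with
  | _ n ih =>
    intro s a
    rcases n with _ | n
    · rw [rootedSum_one, rootedSum_one]
    · rw [rootedSum_succ, rootedSum_succ]
      refine Finset.sum_congr rfl fun i hi => ?_
      rw [Finset.mem_range] at hi
      have e1 := ih i (by omega) (s + 1) (c (s + d + 1))
      have e2 := ih (n - i) (by omega) (s + 2 * i + 2) fun k => a (k + 1)
      rw [show s + 1 + d = s + d + 1 by omega,
        show s + d + 1 + 2 * i + 1 = s + d + 2 * i + 2 by omega,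
        show s + 1 + 2 * i + 1 = s + 2 * i + 2 by omega] at e1
      rw [show s + 2 * i + 2 + d = s + d + 2 * i + 2 by omega,
        show s + d + 2 * i + 2 + 2 * (n - i) + 1 = s + d + 2 * (n + 1) + 1 by omega,
        show s + 2 * i + 2 + 2 * (n - i) + 1 = s + 2 * (n + 1) + 1 by omega] at e2
      rw [e1, e2, show s + d + 1 = s + 1 + d by omega]

/-- The generating series of the rooted sums on the intervals `[s, s + 2 n + 1)`. -/
noncomputable def rootedSeries (c : ℕ → ℕ → ℂ) (s : ℕ) (a : ℕ → ℂ) : ℂ⟦X⟧ :=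
  PowerSeries.mk fun n => rootedSum c s (s + 2 * n + 1) a

theorem rootedSeries_add (c : ℕ → ℕ → ℂ) (s d : ℕ) (a : ℕ → ℂ) :
    rootedSeries c (s + d) a = rootedSeries (fun x => c (x + d)) s a := by
  ext n
  simp only [rootedSeries, PowerSeries.coeff_mk, rootedSum_translate]

/-- The constant term is the one-point interval. Otherwise `rootedSum_succ` is a Cauchy product once
the right-hand pieces, which start at varying points of the parity of `s`, are translated back to
`s`; this uses that `c` has period two. -/
theorem rootedSeries_recursion (c : ℕ → ℕ → ℂ) (hc : ∀ x, c (x + 2) = c x) (s : ℕ)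
    (a : ℕ → ℂ) :
    rootedSeries c s a = PowerSeries.C (a 1) +
      PowerSeries.X * rootedSeries c (s + 1) (c (s + 1)) *
        rootedSeries c s fun k => a (k + 1) := by
  have hper : ∀ i x, c (x + 2 * i) = c x := by
    intro i
    induction i with
    | zero => simp
    | succ i ih =>
      intro x
      rw [show x + 2 * (i + 1) = x + 2 * i + 2 by omega, hc, ih]
  ext n
  rcases n with _ | n
  · simp [rootedSeries, rootedSum_one]
  · rw [map_add, PowerSeries.coeff_C, if_neg (Nat.succ_ne_zero n), zero_add, mul_assoc,
      PowerSeries.coeff_succ_X_mul, PowerSeries.coeff_mul,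
      Finset.Nat.sum_antidiagonal_eq_sum_range_succ_mk, rootedSeries, PowerSeries.coeff_mk,
      rootedSum_succ]
    refine Finset.sum_congr rfl fun i hi => ?_
    rw [Finset.mem_range] at hi
    simp only [rootedSeries, PowerSeries.coeff_mk]
    have e := rootedSum_translate c (2 * (i + 1)) (n - i) s fun k => a (k + 1)
    simp only [hper] at e
    rw [← e]
    congr 2 <;> omega

/-- Each step along the root class shifts `a` and contributes one factor, the variable times the
series of the gap. The coefficient sequence starts at `a 1` because a class is never empty. -/
theorem rootedSeries_eq_subst (c : ℕ → ℕ → ℂ) (hc : ∀ x, c (x + 2) = c x) (s : ℕ)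
    (a : ℕ → ℂ) :
    rootedSeries c s a = (PowerSeries.mk fun k => a (k + 1)).subst
      (PowerSeries.X * rootedSeries c (s + 1) (c (s + 1))) := by
  have hrec := rootedSeries_recursion c hc s
  have h := eq_mul_subst_of_recursion
    (fun a => PowerSeries.C (a 0) +
      PowerSeries.X * rootedSeries c (s + 1) (c (s + 1)) * rootedSeries c s a)
    (t := PowerSeries.X * rootedSeries c (s + 1) (c (s + 1))) (t' := 1) (by simp)
    (fun a => by rw [hrec a, mul_one]) (fun k => a (k + 1))
  rw [hrec a, h, one_mul]

end Weights

/-! ### Encoding `(π, Kr(π))` as a complementary relation. -/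

section Interlacing

theorem mem_part_comm {N : ℕ} (π : Part N) {i j : Fin N} : j ∈ π.part i ↔ i ∈ π.part j := by
  rw [Finpartition.mem_part_iff_part_eq_part _ (Finset.mem_univ _) (Finset.mem_univ _),
    Finpartition.mem_part_iff_part_eq_part _ (Finset.mem_univ _) (Finset.mem_univ _), eq_comm]

theorem part_eq_part {N : ℕ} (π : Part N) {i j : Fin N} (h : j ∈ π.part i) :
    π.part j = π.part i :=
  π.part_eq_of_mem (π.part_mem.2 (Finset.mem_univ i)) h

theorem part_ext {N : ℕ} {π σ : Part N} (h : ∀ i j, j ∈ π.part i ↔ j ∈ σ.part i) : π = σ := by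
  have h' : ∀ i, π.part i = σ.part i := fun i => Finset.ext (h i)
  have key : ∀ {π σ : Part N}, (∀ i, π.part i = σ.part i) → π.parts ⊆ σ.parts := by
    intro π σ h' B hB
    obtain ⟨b, hb⟩ := π.nonempty_of_mem_parts hB
    rw [← π.part_eq_of_mem hB hb, h']
    exact σ.part_mem.2 (Finset.mem_univ b)
  exact Finpartition.ext (Finset.Subset.antisymm (key h') (key fun i => (h' i).symm))

theorem NonCrossing.mem_part {N : ℕ} {π : Part N} (hπ : NonCrossing π.parts) {i j k l : Fin N}
    (hik : k ∈ π.part i) (hjl : l ∈ π.part j) (hij : i < j) (hjk : j < k) (hkl : k < l) :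
    j ∈ π.part i := by
  rw [hπ _ (π.part_mem.2 (Finset.mem_univ i)) _ (π.part_mem.2 (Finset.mem_univ j)) i
    (π.mem_part (Finset.mem_univ i)) j (π.mem_part (Finset.mem_univ j)) k hik l hjl hij hjk hkl]
  exact π.mem_part (Finset.mem_univ j)

theorem krewerasSetoid_iff {N : ℕ} (π : Part N) (i j : Fin N) :
    (krewerasSetoid π).r i j ↔
      ∀ x y, y ∈ π.part x → ((i < x ↔ j < x) ↔ (i < y ↔ j < y)) := by
  constructor
  · intro h x y hy
    exact h _ (π.part_mem.2 (Finset.mem_univ x)) x (π.mem_part (Finset.mem_univ x)) y hy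
  · intro h B hB x hx y hy
    exact h x y (by rwa [π.part_eq_of_mem hB hx])

theorem krewerasSetoid_of_forall {N : ℕ} (π : Part N) {i j : Fin N} (hij : i ≤ j)
    (h : ∀ x y, y ∈ π.part x → i < x → x ≤ j → i < y ∧ y ≤ j) : (krewerasSetoid π).r i j := by
  rw [krewerasSetoid_iff]
  intro x y hy
  have h1 := h x y hy
  have h2 := h y x ((mem_part_comm π).1 hy)
  omega

/-- Elements in different blocks are separated by a block of the Kreweras complement. -/
theorem exists_separating {n : ℕ} {π : Part (n + 1)} (hπ : NonCrossing π.parts)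
    {i j : Fin (n + 1)} (hij : i < j) (h : j ∉ π.part i) (h0 : 0 ∉ π.part i) :
    ∃ p q, (krewerasSetoid π).r p q ∧ i ≤ p ∧ p < j ∧ (q < i ∨ j ≤ q) := by
  have hi : i ∈ π.part i := π.mem_part (Finset.mem_univ i)
  obtain ⟨p, hp, hpmax⟩ : ∃ p ∈ (π.part i).filter (· < j),
      ∀ x ∈ (π.part i).filter (· < j), x ≤ p :=
    Finset.exists_max_image _ id ⟨i, by simp [hi, hij]⟩
  obtain ⟨hpB, hpj⟩ := Finset.mem_filter.1 hp
  have hip : i ≤ p := hpmax i (by simp [hi, hij])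
  have hpart : ∀ {x}, x ∈ π.part i → π.part x = π.part i := fun hx => part_eq_part π hx
  have hcl : ∀ {x y}, y ∈ π.part x → (x ∈ π.part i ↔ y ∈ π.part i) := by
    intro x y hy
    rw [mem_part_comm π, mem_part_comm π (j := y), part_eq_part π hy]
  by_cases hex : ((π.part i).filter (j < ·)).Nonempty
  · obtain ⟨q, hq, hqmin⟩ : ∃ q ∈ (π.part i).filter (j < ·),
        ∀ x ∈ (π.part i).filter (j < ·), q ≤ x := Finset.exists_min_image _ id hex
    obtain ⟨hqB, hjq⟩ := Finset.mem_filter.1 hq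
    -- Here `p` and `q` are the neighbours of `j` in the block of `i`. The barred symbols just after
    -- `p` and just before `q` enclose no block partially, by non-crossing, and the latter has index
    -- `q - 1`.
    refine ⟨p, ⟨q - 1, by omega⟩, krewerasSetoid_of_forall π ?_ ?_, hip, hpj, Or.inr ?_⟩
    · simp only [Fin.le_def, Fin.lt_def] at *; omega
    · intro x y hy hpx hxq
      have hxq' : x < q := by simp only [Fin.le_def, Fin.lt_def] at *; omega
      have hxB : x ∉ π.part i := by
        intro hx
        rcases lt_trichotomy x j with hlt | rfl | hgt
        · exact absurd (hpmax x (by simp [hx, hlt])) (not_le.2 hpx)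
        · exact h hx
        · exact absurd (hqmin x (by simp [hx, hgt])) (not_le.2 hxq')
      have hyB : y ∉ π.part i := fun hy' => hxB ((hcl hy).2 hy')
      have h1 : ¬ y < p := fun hyp => hyB (by
        have := hπ.mem_part ((mem_part_comm π).1 hy) (by rw [hpart hpB]; exact hqB) hyp hpx hxq'
        exact (hcl this).2 hpB)
      have h2 : ¬ q < y := fun hqy => hxB (by
        have := hπ.mem_part (by rw [hpart hpB]; exact hqB) hy hpx hxq' hqy
        rwa [hpart hpB] at this)
      have h3 : y ≠ p := fun he => hyB (he ▸ hpB)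
      have h4 : y ≠ q := fun he => hyB (he ▸ hqB)
      simp only [Fin.le_def, Fin.lt_def, ne_eq, Fin.ext_iff] at *
      omega
    · simp only [Fin.le_def, Fin.lt_def] at *; omega
  · obtain ⟨m, hmB, hmmin⟩ : ∃ m ∈ π.part i, ∀ x ∈ π.part i, m ≤ x :=
      Finset.exists_min_image _ id ⟨i, hi⟩
    have hm0 : m ≠ 0 := fun he => h0 (he ▸ hmB)
    have hm0' : (m : ℕ) ≠ 0 := fun he => hm0 (Fin.ext he)
    have hmi := hmmin i hi
    have hle : ∀ x ∈ π.part i, x ≤ p := by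
      intro x hx
      rcases lt_trichotomy x j with hlt | rfl | hgt
      · exact hpmax x (by simp [hx, hlt])
      · exact absurd hx h
      · exact absurd ⟨x, by simp [hx, hgt]⟩ hex
    -- The block of `i` ends before `j`, so its whole span from `m` to `p` is enclosed; the symbol
    -- with index `m - 1` exists because the block does not contain `0`.
    refine ⟨p, ⟨m - 1, by omega⟩, (krewerasSetoid π).symm (krewerasSetoid_of_forall π ?_ ?_),
      hip, hpj, Or.inl ?_⟩
    · simp only [Fin.le_def] at *; omega
    · intro x y hy hmx hxp
      by_cases hxB : x ∈ π.part i
      · have hyB := (hcl hy).1 hxB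
        have h1 := hmmin y hyB
        have h2 := hle y hyB
        simp only [Fin.le_def, Fin.lt_def] at *
        omega
      · have hyB : y ∉ π.part i := fun hy' => hxB ((hcl hy).2 hy')
        have hxm : x ≠ m := fun he => hxB (he ▸ hmB)
        have hxp' : x ≠ p := fun he => hxB (he ▸ hpB)
        have hmx' : m < x := by
          simp only [Fin.le_def, Fin.lt_def, ne_eq, Fin.ext_iff] at *; omega
        have hxp'' : x < p := lt_of_le_of_ne hxp hxp'
        have h1 : ¬ y < m := fun hym => hyB (by
          have := hπ.mem_part ((mem_part_comm π).1 hy) (by rw [hpart hmB]; exact hpB) hym hmx'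
            hxp''
          exact (hcl this).2 hmB)
        have h2 : ¬ p < y := fun hpy => hxB (by
          have := hπ.mem_part (by rw [hpart hmB]; exact hpB) hy hmx' hxp'' hpy
          rwa [hpart hmB] at this)
        simp only [Fin.le_def, Fin.lt_def] at *
        omega
    · simp only [Fin.le_def, Fin.lt_def] at *; omega

/-- The relation on `[1, 2 n + 2)` given by a partition `π`, in which the first element is a
block by itself, on the even numbers and by `Kr(π)` on the odd numbers. -/
noncomputable def interlaceRel {n : ℕ} (π : Part (n + 1)) : Finset (ℕ × ℕ) :=
  open Classical in
  (Finset.Ico 1 (2 * n + 2) ×ˢ Finset.Ico 1 (2 * n + 2)).filter fun p =>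
    (∃ i j : Fin (n + 1), p = (2 * (i : ℕ), 2 * (j : ℕ)) ∧ j ∈ π.part i) ∨
    ∃ i j : Fin (n + 1), p = (2 * (i : ℕ) + 1, 2 * (j : ℕ) + 1) ∧ (krewerasSetoid π).r i j

variable {n : ℕ} {π : Part (n + 1)}

theorem mem_interlaceRel {x y : ℕ} : (x, y) ∈ interlaceRel π ↔
    ((1 ≤ x ∧ x < 2 * n + 2) ∧ (1 ≤ y ∧ y < 2 * n + 2)) ∧
    ((∃ i j : Fin (n + 1), x = 2 * (i : ℕ) ∧ y = 2 * (j : ℕ) ∧ j ∈ π.part i) ∨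
    ∃ i j : Fin (n + 1), x = 2 * (i : ℕ) + 1 ∧ y = 2 * (j : ℕ) + 1 ∧
      (krewerasSetoid π).r i j) := by
  simp only [interlaceRel, Finset.mem_filter, Finset.mem_product, Finset.mem_Ico, Prod.mk.injEq,
    and_assoc]

theorem even_mem_interlaceRel {i j : Fin (n + 1)} :
    (2 * (i : ℕ), 2 * (j : ℕ)) ∈ interlaceRel π ↔ i ≠ 0 ∧ j ≠ 0 ∧ j ∈ π.part i := by
  rw [mem_interlaceRel]
  have hi : i ≠ 0 ↔ 1 ≤ (i : ℕ) := by rw [ne_eq, Fin.ext_iff, Fin.val_zero]; omega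
  have hj : j ≠ 0 ↔ 1 ≤ (j : ℕ) := by rw [ne_eq, Fin.ext_iff, Fin.val_zero]; omega
  rw [hi, hj]
  constructor
  · rintro ⟨hb, ⟨i', j', h1, h2, h3⟩ | ⟨i', j', h1, h2, h3⟩⟩
    · obtain rfl : i = i' := Fin.ext (by omega)
      obtain rfl : j = j' := Fin.ext (by omega)
      exact ⟨by omega, by omega, h3⟩
    · omega
  · rintro ⟨h1, h2, h3⟩
    exact ⟨by omega, Or.inl ⟨i, j, rfl, rfl, h3⟩⟩

theorem odd_mem_interlaceRel {i j : Fin (n + 1)} :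
    (2 * (i : ℕ) + 1, 2 * (j : ℕ) + 1) ∈ interlaceRel π ↔ (krewerasSetoid π).r i j := by
  rw [mem_interlaceRel]
  constructor
  · rintro ⟨hb, ⟨i', j', h1, h2, h3⟩ | ⟨i', j', h1, h2, h3⟩⟩
    · omega
    · obtain rfl : i = i' := Fin.ext (by omega)
      obtain rfl : j = j' := Fin.ext (by omega)
      exact h3
  · intro h
    exact ⟨by omega, Or.inr ⟨i, j, rfl, rfl, h⟩⟩

theorem part_zero (h0 : {0} ∈ π.parts) : π.part 0 = {0} :=
  π.part_eq_of_mem h0 (Finset.mem_singleton_self 0)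

theorem eq_zero_iff_of_mem_part (h0 : {0} ∈ π.parts) {i j : Fin (n + 1)} (h : j ∈ π.part i) :
    i = 0 ↔ j = 0 := by
  constructor
  · rintro rfl
    rwa [part_zero h0, Finset.mem_singleton] at h
  · rintro rfl
    rwa [mem_part_comm, part_zero h0, Finset.mem_singleton] at h

/-- For odd numbers this is the definition of the Kreweras relation, the missing block `{0}` being
unable to separate anything. For even numbers it says that `Kr(π)` determines `π`, which is
`exists_separating`. -/
theorem complementary_interlaceRel (hπ : NonCrossing π.parts) (h0 : {0} ∈ π.parts) :
    Complementary 1 (2 * n + 2) (interlaceRel π) := by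
  intro i j
  constructor
  · intro hij
    obtain ⟨⟨hi, hj⟩, h⟩ := mem_interlaceRel.1 hij
    refine ⟨hi, hj, ?_, fun x y hxy hp => ?_⟩
    · rcases h with ⟨i', j', rfl, rfl, h⟩ | ⟨i', j', rfl, rfl, h⟩ <;> omega
    · obtain ⟨-, h'⟩ := mem_interlaceRel.1 hxy
      rcases h with ⟨i', j', rfl, rfl, h⟩ | ⟨i', j', rfl, rfl, h⟩ <;>
        rcases h' with ⟨x', y', rfl, rfl, h'⟩ | ⟨x', y', rfl, rfl, h'⟩
      · omega
      · have := (krewerasSetoid_iff π _ _).1 h' _ _ h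
        omega
      · have := (krewerasSetoid_iff π _ _).1 h _ _ h'
        omega
      · omega
  · rintro ⟨hi, hj, hp, hsep⟩
    rcases Nat.even_or_odd' i with ⟨i', rfl | rfl⟩
    · obtain ⟨j', rfl⟩ : ∃ j', j = 2 * j' := ⟨j / 2, by omega⟩
      lift i' to Fin (n + 1) using by omega
      lift j' to Fin (n + 1) using by omega
      have hi0 : i' ≠ 0 := by rintro rfl; simp at hi
      have hj0 : j' ≠ 0 := by rintro rfl; simp at hj
      have hne : ∀ {k : Fin (n + 1)}, k ≠ 0 → 0 ∉ π.part k := fun hk h =>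
        hk ((eq_zero_iff_of_mem_part h0 h).2 rfl)
      rw [even_mem_interlaceRel]
      refine ⟨hi0, hj0, ?_⟩
      by_contra hcon
      rcases lt_trichotomy i' j' with hlt | rfl | hgt
      · obtain ⟨p, q, hr, h1, h2, h3⟩ := exists_separating hπ hlt hcon (hne hi0)
        have := hsep _ _ (odd_mem_interlaceRel.2 hr) (by omega)
        simp only [Fin.le_def, Fin.lt_def] at *
        omega
      · exact hcon (π.mem_part (Finset.mem_univ _))
      · obtain ⟨p, q, hr, h1, h2, h3⟩ :=
          exists_separating hπ hgt (fun h => hcon ((mem_part_comm π).1 h)) (hne hj0)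
        have := hsep _ _ (odd_mem_interlaceRel.2 hr) (by omega)
        simp only [Fin.le_def, Fin.lt_def] at *
        omega
    · obtain ⟨j', rfl⟩ : ∃ j', j = 2 * j' + 1 := ⟨j / 2, by omega⟩
      lift i' to Fin (n + 1) using by omega
      lift j' to Fin (n + 1) using by omega
      rw [odd_mem_interlaceRel, krewerasSetoid_iff]
      intro x y hy
      by_cases hx : x = 0
      · rw [hx, (eq_zero_iff_of_mem_part h0 hy).1 hx]
      · have hy0 : y ≠ 0 := fun h => hx ((eq_zero_iff_of_mem_part h0 hy).2 h)
        have := hsep _ _ (even_mem_interlaceRel.2 ⟨hx, hy0, hy⟩) (by omega)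
        simp only [Fin.lt_def]
        omega

theorem interlaceRel_injective {σ : Part (n + 1)} (h0 : {0} ∈ π.parts) (h0' : {0} ∈ σ.parts)
    (h : interlaceRel π = interlaceRel σ) : π = σ := by
  refine part_ext fun i j => ?_
  have key : ∀ {π : Part (n + 1)}, {0} ∈ π.parts → (j ∈ π.part i ↔ (i = 0 ∧ j = 0) ∨
      (2 * (i : ℕ), 2 * (j : ℕ)) ∈ interlaceRel π) := by
    intro π h0
    rw [even_mem_interlaceRel]
    constructor
    · intro hj
      have := eq_zero_iff_of_mem_part h0 hj
      tauto
    · rintro (⟨rfl, rfl⟩ | h)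
      · exact π.mem_part (Finset.mem_univ _)
      · exact h.2.2
  rw [key h0, key h0', h]

/-- The even classes, with `0` added as a singleton, define `π`; complementarity then forces the odd
classes to be those of `Kr(π)`. -/
theorem exists_interlaceRel_eq {E : Finset (ℕ × ℕ)} (hE : Complementary 1 (2 * n + 2) E) :
    ∃ π : Part (n + 1), NonCrossing π.parts ∧ {0} ∈ π.parts ∧ interlaceRel π = E := by
  classical
  let r : Setoid (Fin (n + 1)) :=
    { r := fun i j => i = j ∨ (2 * (i : ℕ), 2 * (j : ℕ)) ∈ E
      iseqv :=
        { refl := fun i => Or.inl rfl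
          symm := by
            rintro i j (rfl | h)
            · exact Or.inl rfl
            · exact Or.inr (hE.symm h)
          trans := by
            rintro i j k (rfl | h) (rfl | h')
            · exact Or.inl rfl
            · exact Or.inr h'
            · exact Or.inr h
            · exact Or.inr (hE.trans h h') } }
  obtain ⟨π, hπ⟩ : ∃ π : Part (n + 1), ∀ i j, j ∈ π.part i ↔
      i = j ∨ (2 * (i : ℕ), 2 * (j : ℕ)) ∈ E :=
    ⟨Finpartition.ofSetoid r, fun i j => Finpartition.mem_part_ofSetoid_iff_rel⟩
  refine ⟨π, ?_, ?_, ?_⟩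
  · intro B hB C hC i hi j hj k hk l hl hij hjk hkl
    rw [← π.part_eq_of_mem hB hi, hπ] at hk
    rw [← π.part_eq_of_mem hC hj, hπ] at hl
    have h1 := hk.resolve_left (by omega)
    have h2 := hl.resolve_left (by omega)
    have := (hπ i j).2 (Or.inr (hE.noncrossing h1 h2 (by omega) (by omega) (by omega)))
    rw [π.part_eq_of_mem hB hi] at this
    exact π.eq_of_mem_parts hB hC this hj
  · have : π.part 0 = {0} := by
      ext j
      rw [hπ, Finset.mem_singleton]
      constructor
      · rintro (h | h)
        · exact h.symm
        · have := hE.bounds h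
          simp at this
      · exact fun h => Or.inl h.symm
    rw [← this]
    exact π.part_mem.2 (Finset.mem_univ 0)
  · ext ⟨x, y⟩
    rw [mem_interlaceRel]
    constructor
    · rintro ⟨hb, ⟨i, j, rfl, rfl, h⟩ | ⟨i, j, rfl, rfl, h⟩⟩
      · rcases (hπ i j).1 h with rfl | h
        · exact hE.refl hb.1.1 hb.1.2
        · exact h
      · refine (hE _ _).2 ⟨hb.1, hb.2, by omega, fun x y hxy hp => ?_⟩
        have b1 := hE.bounds hxy
        obtain ⟨x', rfl⟩ : ∃ x', x = 2 * x' := ⟨x / 2, by omega⟩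
        obtain ⟨y', rfl⟩ : ∃ y', y = 2 * y' := ⟨y / 2, by omega⟩
        lift x' to Fin (n + 1) using by omega
        lift y' to Fin (n + 1) using by omega
        have := (krewerasSetoid_iff π _ _).1 h x' y' ((hπ _ _).2 (Or.inr hxy))
        simp only [Fin.lt_def] at this
        omega
    · intro hxy
      have b1 := hE.bounds hxy
      refine ⟨⟨b1.1, b1.2.1⟩, ?_⟩
      rcases Nat.even_or_odd' x with ⟨i, rfl | rfl⟩
      · obtain ⟨j, rfl⟩ : ∃ j, y = 2 * j := ⟨y / 2, by omega⟩
        lift i to Fin (n + 1) using by omega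
        lift j to Fin (n + 1) using by omega
        exact Or.inl ⟨i, j, rfl, rfl, (hπ _ _).2 (Or.inr hxy)⟩
      · obtain ⟨j, rfl⟩ : ∃ j, y = 2 * j + 1 := ⟨y / 2, by omega⟩
        lift i to Fin (n + 1) using by omega
        lift j to Fin (n + 1) using by omega
        refine Or.inr ⟨i, j, rfl, rfl, (krewerasSetoid_iff π _ _).2 fun x y hy => ?_⟩
        rcases (hπ _ _).1 hy with rfl | hy
        · rfl
        · have := hE.not_separated hxy hy (by omega)
          simp only [Fin.lt_def]
          omega

end Interlacing

/-! ### The modified boxed convolution as a rooted series, and the subordination system. -/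

section Weights

/-- Each block is represented by its least element, matching the form of `leastWeight`. -/
theorem Cf_eq_prod_least {N : ℕ} (f : ℂ⟦X⟧) (π : Part N) :
    Cf f π = ∏ i : Fin N,
      if ∀ j < i, j ∉ π.part i then PowerSeries.coeff (π.part i).card f else 1 := by
  rw [← Finset.prod_filter, Cf, eq_comm]
  refine Finset.prod_bij (fun i _ => π.part i) (fun i _ => π.part_mem.2 (Finset.mem_univ i)) ?_ ?_
    (fun _ _ => rfl)
  · intro i hi j hj h
    simp only [Finset.mem_filter, Finset.mem_univ, true_and] at hi hj
    rcases lt_trichotomy i j with hlt | rfl | hgt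
    · exact absurd (h ▸ π.mem_part (Finset.mem_univ i)) (hj i hlt)
    · rfl
    · exact absurd (h.symm ▸ π.mem_part (Finset.mem_univ j)) (hi j hgt)
  · intro B hB
    obtain ⟨b, hb, hmin⟩ := Finset.exists_min_image B id (π.nonempty_of_mem_parts hB)
    refine ⟨b, ?_, π.part_eq_of_mem hB hb⟩
    simp only [Finset.mem_filter, Finset.mem_univ, true_and]
    intro j hj hjB
    rw [π.part_eq_of_mem hB hb] at hjB
    exact absurd (hmin j hjB) (not_le.2 hj)

theorem leastWeight_eq_of_part (c : ℕ → ℕ → ℂ) {N : ℕ} (ρ : Part N) {E : Finset (ℕ × ℕ)}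
    {e : Fin N → ℕ} (he : StrictMono e) {i : Fin N}
    (h : ∀ y, (e i, y) ∈ E ↔ ∃ j ∈ ρ.part i, y = e j) :
    leastWeight c E (e i) =
      if ∀ j < i, j ∉ ρ.part i then c (e i) (ρ.part i).card else 1 := by
  have hs : classSize E (e i) = (ρ.part i).card := by
    rw [classSize, ← Finset.card_image_of_injective (ρ.part i) (f := fun j => (e i, e j))
      (fun j k hjk => he.injective (Prod.mk.inj hjk).2)]
    congr 1
    ext ⟨x, y⟩
    simp only [Finset.mem_filter, Finset.mem_image, Prod.mk.injEq]
    constructor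
    · rintro ⟨hxy, rfl⟩
      obtain ⟨j, hj, rfl⟩ := (h y).1 hxy
      exact ⟨j, hj, rfl, rfl⟩
    · rintro ⟨j, hj, rfl, rfl⟩
      exact ⟨(h _).2 ⟨j, hj, rfl⟩, rfl⟩
  have hc : (∀ y < e i, (e i, y) ∉ E) ↔ ∀ j < i, j ∉ ρ.part i := by
    constructor
    · intro h' j hj hjp
      exact h' (e j) (he hj) ((h _).2 ⟨j, hjp, rfl⟩)
    · intro h' y hy hyE
      obtain ⟨j, hj, rfl⟩ := (h y).1 hyE
      exact h' j (he.lt_iff_lt.1 hy) hj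
  simp only [leastWeight, hs, hc]

theorem prod_range_two_mul (F : ℕ → ℂ) (N : ℕ) :
    ∏ x ∈ Finset.range (2 * N), F x =
      (∏ i : Fin N, F (2 * (i : ℕ))) * ∏ i : Fin N, F (2 * (i : ℕ) + 1) := by
  rw [← Finset.prod_range fun i => F (2 * i), ← Finset.prod_range fun i => F (2 * i + 1)]
  induction N with
  | zero => simp
  | succ N ih =>
    rw [show 2 * (N + 1) = 2 * N + 1 + 1 by omega, Finset.prod_range_succ, Finset.prod_range_succ,
      Finset.prod_range_succ, Finset.prod_range_succ, ih]
    ring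

/-- The weights which are the coefficients of `f` at even and of `g` at odd numbers. -/
noncomputable def parityWeight (f g : ℂ⟦X⟧) (x k : ℕ) : ℂ :=
  if x % 2 = 0 then PowerSeries.coeff k f else PowerSeries.coeff k g

theorem Cf_mul_Cf_kreweras (f g : ℂ⟦X⟧) {n : ℕ} {π : Part (n + 1)} (hπ : NonCrossing π.parts)
    (h0 : {0} ∈ π.parts) :
    Cf f π * Cf g (kreweras π) = PowerSeries.coeff 1 f *
      (parityWeight f g 1 (classSize (interlaceRel π) 1) *
        ∏ x ∈ Finset.Ico (1 + 1) (2 * n + 2),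
          leastWeight (parityWeight f g) (interlaceRel π) x) := by
  -- The number `0` lies outside the interval of `interlaceRel`; the value there is the weight of
  -- the singleton block `{0}`.
  let F : ℕ → ℂ := fun x =>
    if x = 0 then PowerSeries.coeff 1 f else leastWeight (parityWeight f g) (interlaceRel π) x
  have hF : ∏ x ∈ Finset.range (2 * (n + 1)), F x = PowerSeries.coeff 1 f *
      (leastWeight (parityWeight f g) (interlaceRel π) 1 *
        ∏ x ∈ Finset.Ico (1 + 1) (2 * n + 2),
          leastWeight (parityWeight f g) (interlaceRel π) x) := by
    rw [Finset.range_eq_Ico, Finset.prod_eq_prod_Ico_succ_bot (show 0 < 2 * (n + 1) by omega) F,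
      ← Finset.prod_eq_prod_Ico_succ_bot (show 1 < 2 * n + 2 by omega)
        (leastWeight (parityWeight f g) (interlaceRel π))]
    congr 1
    refine Finset.prod_congr rfl fun x hx => ?_
    rw [Finset.mem_Ico] at hx
    exact if_neg (by omega)
  rw [← (complementary_interlaceRel hπ h0).leastWeight_left (parityWeight f g), ← hF,
    prod_range_two_mul, Cf_eq_prod_least, Cf_eq_prod_least]
  congr 1
  · refine Finset.prod_congr rfl fun i _ => ?_
    by_cases hi : i = 0
    · subst hi
      simp [F, part_zero h0]
    · have hi' : 2 * (i : ℕ) ≠ 0 := by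
        have : (i : ℕ) ≠ 0 := fun h => hi (Fin.ext h)
        omega
      simp only [F, if_neg hi']
      rw [leastWeight_eq_of_part (parityWeight f g) π (e := fun i => 2 * (i : ℕ))
        (fun i j hij => by simp only [Fin.lt_def] at *; omega)]
      · simp [parityWeight]
      · intro y
        constructor
        · intro hy
          obtain ⟨i', j', h1, rfl, hj⟩ | ⟨i', j', h1, rfl, hj⟩ := (mem_interlaceRel.1 hy).2
          · obtain rfl : i = i' := Fin.ext (by omega)
            exact ⟨j', hj, rfl⟩
          · omega
        · rintro ⟨j, hj, rfl⟩
          have := eq_zero_iff_of_mem_part h0 hj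
          exact even_mem_interlaceRel.2 ⟨hi, by tauto, hj⟩
  · refine Finset.prod_congr rfl fun i _ => ?_
    simp only [F, if_neg (Nat.succ_ne_zero _)]
    rw [leastWeight_eq_of_part (parityWeight f g) (kreweras π) (e := fun i => 2 * (i : ℕ) + 1)
      (fun i j hij => by simp only [Fin.lt_def] at *; omega)]
    · simp [parityWeight, Nat.add_mod]
    · have hk : ∀ i j, j ∈ (kreweras π).part i ↔ (krewerasSetoid π).r i j := fun i j => by
        rw [kreweras, Finpartition.mem_part_ofSetoid_iff_rel]
      intro y
      constructor
      · intro hy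
        obtain ⟨i', j', h1, rfl, hj⟩ | ⟨i', j', h1, rfl, hj⟩ := (mem_interlaceRel.1 hy).2
        · omega
        · obtain rfl : i = i' := Fin.ext (by omega)
          exact ⟨j', (hk _ _).2 hj, rfl⟩
      · rintro ⟨j, hj, rfl⟩
        exact odd_mem_interlaceRel.2 ((hk _ _).1 hj)

/-- The scalar cancels the weight of `{0}`. What remains starts at the odd number `1`, so the root
class is a block of `Kr(π)` and is weighted by `g`. -/
theorem smul_modBoxConv_eq {f : ℂ⟦X⟧} (hf : PowerSeries.coeff 1 f ≠ 0) (g : ℂ⟦X⟧) :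
    (1 / PowerSeries.coeff 1 f) • modBoxConv f g =
      PowerSeries.X * rootedSeries (parityWeight f g) 1 fun k => PowerSeries.coeff k g := by
  ext n
  rcases n with _ | n
  · simp [modBoxConv]
  · rw [PowerSeries.coeff_succ_X_mul, rootedSeries, PowerSeries.coeff_mk, map_smul, modBoxConv,
      PowerSeries.coeff_mk, smul_eq_mul, one_div, inv_mul_eq_iff_eq_mul₀ hf, rootedSum,
      Finset.mul_sum, show 1 + 2 * n + 1 = 2 * n + 2 by omega]
    refine Finset.sum_bij (fun π _ => interlaceRel π) ?_ ?_ ?_ ?_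
    · intro π hπ
      simp only [NC, Finset.mem_filter, Finset.mem_univ, true_and] at hπ
      exact mem_complementarySet.2 (complementary_interlaceRel hπ.1 hπ.2)
    · intro π hπ σ hσ h
      exact interlaceRel_injective (Finset.mem_filter.1 hπ).2 (Finset.mem_filter.1 hσ).2 h
    · intro E hE
      obtain ⟨π, h1, h2, h3⟩ := exists_interlaceRel_eq (mem_complementarySet.1 hE)
      exact ⟨π, by simp [NC, h1, h2], h3⟩
    · intro π hπ
      simp only [NC, Finset.mem_filter, Finset.mem_univ, true_and] at hπ
      rw [Cf_mul_Cf_kreweras f g hπ.1 hπ.2]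
      simp [parityWeight]

/-- The subordination equation for the modified boxed convolution. -/
theorem smul_modBoxConv_eq_X_mul_subst {f g : ℂ⟦X⟧} (hf : PowerSeries.coeff 1 f ≠ 0)
    (hg : PowerSeries.coeff 1 g ≠ 0) :
    (1 / PowerSeries.coeff 1 f) • modBoxConv f g =
      PowerSeries.X * (divZ g).subst ((1 / PowerSeries.coeff 1 g) • modBoxConv g f) := by
  -- The gap series starts at an even number; translating it by one exchanges the roles of `f` and
  -- `g` and turns it into the series of `modBoxConv g f`.
  have hswap : (fun x => parityWeight f g (x + 1)) = parityWeight g f := by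
    ext x k
    simp only [parityWeight]
    split_ifs <;> first | rfl | omega
  rw [smul_modBoxConv_eq hf, smul_modBoxConv_eq hg, rootedSeries_eq_subst, rootedSeries_add, hswap]
  · rfl
  · intro x
    ext k
    simp [parityWeight]

theorem smul_modBoxConv_ne_zero {f g : ℂ⟦X⟧} (hf : PowerSeries.coeff 1 f ≠ 0)
    (hg : PowerSeries.coeff 1 g ≠ 0) :
    (1 / PowerSeries.coeff 1 f) • modBoxConv f g ≠ 0 := by
  intro h
  have h1 := congrArg (PowerSeries.coeff 1) (smul_modBoxConv_eq hf g)
  rw [h, PowerSeries.coeff_succ_X_mul 0, rootedSeries, PowerSeries.coeff_mk, mul_zero,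
    add_zero, rootedSum_one] at h1
  exact hg h1.symm

end Weights

end CFree

theorem mainTheorem2 {A : Type*} [Ring A] [Algebra ℂ A] (φ ψ : A →ₗ[ℂ] ℂ)
    (hφ : φ 1 = 1) (hψ : ψ 1 = 1) (X Y : A) (hXY : CFree.CondFree φ ψ X Y)
    (hX : ψ X ≠ 0) (hY : ψ Y ≠ 0) :
    CFree.divZ (CFree.cRTransform φ ψ (X * Y)) =
      CFree.comp (CFree.divZ (CFree.cRTransform φ ψ X))
          ((1 / PowerSeries.coeff 1 (CFree.RTransform ψ X)) •
            CFree.modBoxConv (CFree.RTransform ψ X) (CFree.RTransform ψ Y)) *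
        CFree.comp (CFree.divZ (CFree.cRTransform φ ψ Y))
          ((1 / PowerSeries.coeff 1 (CFree.RTransform ψ Y)) •
            CFree.modBoxConv (CFree.RTransform ψ Y) (CFree.RTransform ψ X)) := by
  have hf : PowerSeries.coeff 1 (CFree.RTransform ψ X) ≠ 0 := by
    rwa [CFree.coeff_one_RTransform]
  have hg : PowerSeries.coeff 1 (CFree.RTransform ψ Y) ≠ 0 := by
    rwa [CFree.coeff_one_RTransform]
  exact CFree.divZ_cRTransform_mul hφ hψ hXY (CFree.smul_modBoxConv_ne_zero hf hg)
    (CFree.smul_modBoxConv_ne_zero hg hf) (CFree.smul_modBoxConv_eq_X_mul_subst hf hg)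
    (CFree.smul_modBoxConv_eq_X_mul_subst hg hf)
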